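/- \textbf{Conventions.} For an $n$-qubit system let $\mathrm{STAB}_n$ be the convex hull of the projectors onto pure stabilizer states (unit vectors fixed by exactly $2^n$ elements of the $n$-qubit Pauli group). The robustness of magic of an $n$-qubit state $\rho$ is $\mathcal R(\rho)=\min\{2a+1 : a\ge 0,\ \rho=(a+1)\sigma-a\tau,\ \sigma,\tau\in\mathrm{STAB}_n\}$. Let $\mathcal E_\lambda(\sigma)=(1-\lambda)\sigma+\lambda\,\mathrm{Tr}(\sigma)\,\mathbb I_2/2$ be the depolarizing channel, and for $\epsilon\ge 0$ let $\lambda^*_\epsilon(\rho)=\inf\{\lambda\in[0,1] : \mathcal R(\mathcal E_\lambda^{\otimes n}(\rho))\le 1+\epsilon\}$. For $J\subset[n]$ write $\rho_J$ for the reduced state on the qubits in $J$, and let $\mathcal M_K(\rho)=\max_{|J|=K}\mathcal R(\rho_J)$. A family $\{\rho_n\}$ of $n$-qubit states has \emph{vanishing local magic} if $\lim_{n\to\infty}\mathcal M_K(\rho_n)=1$ for every constant $K$, and a \emph{non-vanishing magic threshold} (for $\epsilon$) if $\liminf_{n\to\infty}\lambda^*_\epsilon(\rho_n)>0$. A family of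 pure states is \emph{efficiently preparable} if its $n$-qubit member is prepared exactly from $|0^n\rangle$ by a circuit of $\mathrm{poly}(n)$ gates from the set consisting of the Hadamard gate, $T=\mathrm{diag}(1,e^{i\pi/4})$, $Z$, $\mathrm CZ$ and $\mathrm{CC}Z$. For a hypergraph with edge set $E$ on a finite vertex set $V$, the hypergraph state is $\prod_{e\in E}\mathrm C^{|e|-1}Z_e|+\rangle^{\otimes V}$. \textbf{Theorem.} There is an efficiently preparable family of $n$-qubit pure states that has vanishing local magic and, for every $\epsilon\ge 0$, a non-vanishing magic threshold. An example is the family of 3-complete hypergraph states $\Gamma_n$, given by the hypergraph on $[n]$ whose edges are all subsets of size $3$: 1. $\Gamma_n$ is prepared exactly from $|0^n\rangle$ by a circuit of $O(n^3)$ gates from the above set. 2. For a finite set $J$ of qubits let $\Phi_0,\Phi_1,\Phi_2,\Phi_3$ be the hypergraph states on $J$ whose edges are, respectively, all subsets of size $3$; all of sizes $3$ and $2$; all of sizes $3$ and $1$; all of sizes $3$, $2$ and $1$. Then $\frac14\sum_{l=0}^3\Phi_l$ is a (mixed) stabilizer state. For every fixed $K$, as $n\to\infty$ the reduced states $(\Gamma_n)_J$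 with $J\subset[n]$, $|J|=K$, converge entrywise to the corresponding $\frac14\sum_{l=0}^3\Phi_l$, uniformly in $J$. 3. $\lim_{n\to\infty}\mathcal M_K(\Gamma_n)=1$ for every $K$, i.e. $\{\Gamma_n\}$ has vanishing local magic. 4. For every $\epsilon\ge 0$, $0.39\le\lambda^*_\epsilon(\Gamma_n)\le 0.78$ for all sufficiently large $n$; in particular $\liminf_{n\to\infty}\lambda^*_\epsilon(\Gamma_n)>0$. -/

import Mathlib

open Filter Topology Matrix

namespace MagicThreshold

/-! Qubits are labelled by a finite type `ι`; the computational basis is indexed by `ι → Fin 2`. -/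

/-- Vectors of the many-qubit Hilbert space, in the computational basis. -/
abbrev Ket (ι : Type) : Type := (ι → Fin 2) → ℂ

/-- Operators on the many-qubit Hilbert space, in the computational basis. -/
abbrev Op (ι : Type) : Type := Matrix (ι → Fin 2) (ι → Fin 2) ℂ

/-- The projector `|ψ⟩⟨ψ|`. -/
def proj {ι : Type} (ψ : Ket ι) : Op ι := vecMulVec ψ (star ψ)

/-- The four single-qubit Pauli matrices `I, X, Y, Z`. -/
def pauli : Fin 4 → Matrix (Fin 2) (Fin 2) ℂ :=
  ![!![1, 0; 0, 1], !![0, 1; 1, 0], !![0, -Complex.I; Complex.I, 0], !![1, 0; 0, -1]]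

section
variable {ι : Type} [Fintype ι]

/-- The Pauli string `⊗ᵢ pauli (p i)`. -/
def pauliString (p : ι → Fin 4) : Op ι := fun s t => ∏ i, pauli (p i) (s i) (t i)

/-- The Pauli group: Pauli strings with a phase in `{1, i, -1, -i}`. -/
def pauliGroup (ι : Type) [Fintype ι] : Set (Op ι) :=
  {M | ∃ (k : Fin 4) (p : ι → Fin 4), M = Complex.I ^ (k : ℕ) • pauliString p}

variable [DecidableEq ι]

/-- A pure stabilizer state: a unit vector fixed by `2 ^ n` elements of the `n`-qubit Pauli
group. -/
structure IsStabilizerKet (ψ : Ket ι) : Prop where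
  unit : ∑ s, ‖ψ s‖ ^ 2 = 1
  card_stabilizer : {M | M ∈ pauliGroup ι ∧ M *ᵥ ψ = ψ}.ncard = 2 ^ Fintype.card ι

/-- The set of stabilizer states: the convex hull of all pure stabilizer states. -/
def STAB (ι : Type) [Fintype ι] [DecidableEq ι] : Set (Op ι) :=
  convexHull ℝ {ρ | ∃ ψ : Ket ι, IsStabilizerKet ψ ∧ ρ = proj ψ}

/-- Robustness of magic. For a density operator `ρ` the set is nonempty and bounded below by `1`. -/
noncomputable def RoM (ρ : Op ι) : ℝ :=
  sInf {r | ∃ a : ℝ, 0 ≤ a ∧ ∃ σ ∈ STAB ι, ∃ τ ∈ STAB ι, ρ = (a + 1) • σ - a • τ ∧ r = 2 * a + 1}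

/-- The single-qubit depolarizing channel `σ ↦ (1 - r) σ + r tr(σ) 𝟙 / 2`. -/
noncomputable def depolarize₁ (r : ℝ) (σ : Matrix (Fin 2) (Fin 2) ℂ) :
    Matrix (Fin 2) (Fin 2) ℂ :=
  (1 - r) • σ + r • ((σ.trace / 2) • (1 : Matrix (Fin 2) (Fin 2) ℂ))

/-- Independent depolarizing noise: the tensor power of `depolarize₁ r`. It is the linear map that
sends `⊗ᵢ |uᵢ⟩⟨vᵢ|` to `⊗ᵢ depolarize₁ r |uᵢ⟩⟨vᵢ|`. -/
noncomputable def depolarize (r : ℝ) (ρ : Op ι) : Op ι := fun s t =>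
  ∑ u, ∑ v, ρ u v * ∏ i, depolarize₁ r (Matrix.single (u i) (v i) 1) (s i) (t i)

/-- The `ε`-magic noise threshold. -/
noncomputable def magicThreshold (ε : ℝ) (ρ : Op ι) : ℝ :=
  sInf {r | 0 ≤ r ∧ r ≤ 1 ∧ RoM (depolarize r ρ) ≤ 1 + ε}

/-- The basis label on all qubits that is `a` on `J` and `c` off `J`. -/
def glue (J : Finset ι) (a : J → Fin 2) (c : ↥Jᶜ → Fin 2) : ι → Fin 2 := fun i =>
  if h : i ∈ J then a ⟨i, h⟩ else c ⟨i, Finset.mem_compl.2 h⟩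

/-- The reduced state on the qubits in `J`; all other qubits are traced out. -/
def reduced (J : Finset ι) (ρ : Op ι) : Op J := fun a b =>
  ∑ c : ↥Jᶜ → Fin 2, ρ (glue J a c) (glue J b c)

/-- Maximum `K`-local robustness of magic (a maximum over a finite set, nonempty if `K ≤ n`). -/
noncomputable def localRoM (K : ℕ) (ρ : Op ι) : ℝ :=
  ⨆ J : {J : Finset ι // J.card = K}, RoM (reduced J.1 ρ)

/-- The diagonal of the multi-controlled `Z` gate on the qubits in `e`. -/
def cZPhase (e : Finset ι) (s : ι → Fin 2) : ℂ := if ∀ i ∈ e, s i = 1 then -1 else 1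

/-- The multi-controlled `Z` gate on the qubits in `e`. -/
def cZ (e : Finset ι) : Op ι := Matrix.diagonal (cZPhase e)

/-- The hypergraph state with edge set `E`: the (diagonal) gates `cZ e`, `e ∈ E`, applied to the
product of the states `|+⟩`. -/
noncomputable def hypergraphKet (E : Finset (Finset ι)) : Ket ι := fun s =>
  (∏ e ∈ E, cZPhase e s) * (((√2 : ℝ) : ℂ)⁻¹) ^ Fintype.card ι

theorem hypergraphKet_empty :
    hypergraphKet (∅ : Finset (Finset ι)) = fun _ => (((√2 : ℝ) : ℂ)⁻¹) ^ Fintype.card ι := by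
  ext s; simp [hypergraphKet]

theorem hypergraphKet_insert {e : Finset ι} {E : Finset (Finset ι)} (he : e ∉ E) :
    hypergraphKet (insert e E) = cZ e *ᵥ hypergraphKet E := by
  ext s; simp [hypergraphKet, cZ, Matrix.mulVec_diagonal, Finset.prod_insert he, mul_assoc]

/-- All edges of degree `d`. -/
def edges (ι : Type) [Fintype ι] (d : ℕ) : Finset (Finset ι) := Finset.powersetCard d Finset.univ

/-- The equal mixture of the four hypergraph states that have all edges of degree `3`, and
all or none of the edges of degree `2`, and all or none of the edges of degree `1`. -/
noncomputable def fourMixture (ι : Type) [Fintype ι] [DecidableEq ι] : Op ι :=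
  (1 / 4 : ℝ) •
    (proj (hypergraphKet (edges ι 3)) + proj (hypergraphKet (edges ι 3 ∪ edges ι 2)) +
      proj (hypergraphKet (edges ι 3 ∪ edges ι 1)) +
      proj (hypergraphKet (edges ι 3 ∪ edges ι 2 ∪ edges ι 1)))

/-- A single-qubit gate `A` acting on qubit `i`. -/
def onQubit (i : ι) (A : Matrix (Fin 2) (Fin 2) ℂ) : Op ι := fun s t =>
  if ∀ j, j ≠ i → s j = t j then A (s i) (t i) else 0

end

/-- Elementary gates: Hadamard, `T = diag(1, e^{iπ/4})`, and `Z`, `CZ`, `CCZ`. -/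
inductive Gate (ι : Type) : Type
  | hadamard (i : ι) : Gate ι
  | t (i : ι) : Gate ι
  | cZ (e : Finset ι) (one_le : 1 ≤ e.card) (le_three : e.card ≤ 3) : Gate ι

section
variable {ι : Type} [Fintype ι] [DecidableEq ι]

/-- The unitary matrix of a gate. -/
noncomputable def Gate.toOp : Gate ι → Op ι
  | .hadamard i => onQubit i ((((√2 : ℝ) : ℂ)⁻¹) • !![1, 1; 1, -1])
  | .t i => onQubit i !![1, 0; 0, Complex.exp (Complex.I * (Real.pi / 4))]
  | .cZ e _ _ => MagicThreshold.cZ e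

/-- The all-zero basis state. -/
def zeroKet (ι : Type) [Fintype ι] [DecidableEq ι] : Ket ι := Pi.single 0 1

/-- The output of a circuit (a list of gates, first gate first) on the all-zero input. -/
noncomputable def output (C : List (Gate ι)) : Ket ι :=
  C.foldl (fun ψ g => g.toOp *ᵥ ψ) (zeroKet ι)

end

/-- A family of pure states prepared exactly by circuits with polynomially many gates. -/
def EfficientlyPreparable (ψ : (n : ℕ) → Ket (Fin n)) : Prop :=
  ∃ p : Polynomial ℕ, ∀ n, ∃ C : List (Gate (Fin n)), output C = ψ n ∧ C.length ≤ p.eval n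

/-- Vanishing local magic: for every constant `K`, the maximum `K`-local robustness of magic
tends to `1`. -/
def VanishingLocalMagic (ρ : (n : ℕ) → Op (Fin n)) : Prop :=
  ∀ K : ℕ, Tendsto (fun n => localRoM K (ρ n)) atTop (𝓝 1)

/-- Non-vanishing `ε`-magic threshold. The sequence takes values in `[0, 1]`. -/
def NonvanishingMagicThreshold (ε : ℝ) (ρ : (n : ℕ) → Op (Fin n)) : Prop :=
  0 < liminf (fun n => magicThreshold ε (ρ n)) atTop

/-- The `3`-complete hypergraph state on `n` qubits: all edges of degree `3`. -/
noncomputable def gammaKet (n : ℕ) : Ket (Fin n) := hypergraphKet (edges (Fin n) 3)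

end MagicThreshold

open MagicThreshold

namespace MagicThreshold

/-! The sign `(-1) ^ w.choose 3` has period 4 in the Hamming weight `w`, so Fourier analysis on ℤ/4
writes the 3-complete hypergraph state as a combination, with coefficients of modulus 1/2, of the
four product states `((|0⟩ + iʳ|1⟩)/√2)^⊗n`. Its projector is therefore a sum of sixteen tensor
powers `outer (r, r')^⊗n` with coefficients of modulus 1/4 (`proj_hypergraphKet_edges_three`), and
partial trace, noise and Pauli expectations all act factor by factor. Local magic: tracing out a
qubit multiplies an off-diagonal term by an overlap of modulus at most 1/√2, so marginals converge
exponentially fast to the uniform mixture of the four diagonal terms. This is a mixture of product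
stabilizer states and equals `fourMixture` (`fourMixture_eq`). Closeness to it bounds the robustness
through `mem_robustnessSet_of_close`. Threshold from below: the ℓ¹-norm of the Pauli spectrum is at
most `2 ^ n` on `STAB`, hence at most `2 ^ n * RoM`. Contracting the spectrum with product phases
adapted to `outer (0, 1)` makes that term grow like `((4 - 3λ)/√2) ^ n`, while the other fifteen
stay within `2 ^ n`; the base exceeds 2 for λ ≤ 0.39. Threshold from above: at λ = 0.78 each noisy
`outer (r, r')` is expanded in the six single-qubit stabilizer projectors, with off-diagonal
coefficients at most 19/20 of the diagonal ones. In the n-fold tensor power the diagonal terms win,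
so all coefficients become nonnegative and the noisy state is a stabilizer state. -/

theorem proj_conjTranspose {ι : Type} (ψ : Ket ι) : (proj ψ)ᴴ = proj ψ := by
  ext a b
  simp [proj, vecMulVec_apply, mul_comm]

/-! ### Product operators under noise and partial trace -/

section Product
variable {ι : Type} [Fintype ι]

/-- The tensor product of single-qubit operators. -/
def prodOp (A : ι → Matrix (Fin 2) (Fin 2) ℂ) : Op ι := fun s t => ∏ i, A i (s i) (t i)

/-- The tensor product of single-qubit vectors. -/
def prodKet (v : ι → Fin 2 → ℂ) : Ket ι := fun s => ∏ i, v i (s i)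

theorem sum_pi_prod [DecidableEq ι] {κ R : Type*} [Fintype κ] [CommSemiring R] (f : ι → κ → R) :
    ∑ s : ι → κ, ∏ i, f i (s i) = ∏ i, ∑ k, f i k := by
  rw [Finset.prod_univ_sum, Fintype.piFinset_univ]

theorem pauliString_eq_prodOp (p : ι → Fin 4) : pauliString p = prodOp fun i => pauli (p i) := rfl

theorem prodOp_smul (c : ι → ℂ) (A : ι → Matrix (Fin 2) (Fin 2) ℂ) :
    prodOp (fun i => c i • A i) = (∏ i, c i) • prodOp A := by
  ext s t
  simp [prodOp, Finset.prod_mul_distrib]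

theorem prodOp_conjTranspose (A : ι → Matrix (Fin 2) (Fin 2) ℂ) :
    (prodOp A)ᴴ = prodOp fun i => (A i)ᴴ := by
  ext s t
  simp [prodOp, Matrix.conjTranspose_apply]

theorem proj_prodKet (v : ι → Fin 2 → ℂ) :
    proj (prodKet v) = prodOp fun i => vecMulVec (v i) (star (v i)) := by
  ext s t
  simp [proj, prodKet, prodOp, vecMulVec_apply, Finset.prod_mul_distrib]

variable [DecidableEq ι]

theorem prodOp_mul (A B : ι → Matrix (Fin 2) (Fin 2) ℂ) :
    prodOp A * prodOp B = prodOp fun i => A i * B i := by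
  ext s t
  simp only [prodOp, Matrix.mul_apply, ← Finset.prod_mul_distrib]
  exact sum_pi_prod fun i k => A i (s i) k * B i k (t i)

theorem trace_prodOp (A : ι → Matrix (Fin 2) (Fin 2) ℂ) :
    (prodOp A).trace = ∏ i, (A i).trace := by
  simp only [prodOp, Matrix.trace, Matrix.diag]
  exact sum_pi_prod fun i k => A i k k

theorem prodOp_mulVec (A : ι → Matrix (Fin 2) (Fin 2) ℂ) (v : ι → Fin 2 → ℂ) :
    prodOp A *ᵥ prodKet v = prodKet fun i => A i *ᵥ v i := by
  ext s
  simp only [prodOp, prodKet, Matrix.mulVec, dotProduct, ← Finset.prod_mul_distrib]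
  exact sum_pi_prod fun i k => A i (s i) k * v i k

theorem prodOp_sum {W : Type*} [Fintype W] (β : W → ℂ) (P : W → Matrix (Fin 2) (Fin 2) ℂ) :
    prodOp (fun _ : ι => ∑ w, β w • P w) =
      ∑ w : ι → W, (∏ i, β (w i)) • prodOp fun i => P (w i) := by
  ext s t
  simp only [prodOp, Matrix.sum_apply, Matrix.smul_apply, smul_eq_mul, ← Finset.prod_mul_distrib]
  exact (sum_pi_prod fun i w => β w * P w (s i) (t i)).symm

theorem depolarize₁_eq_sum (r : ℝ) (A : Matrix (Fin 2) (Fin 2) ℂ) (a b : Fin 2) :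
    depolarize₁ r A a b = ∑ u, ∑ v, A u v * depolarize₁ r (Matrix.single u v 1) a b := by
  fin_cases a <;> fin_cases b <;>
    simp [depolarize₁, Fin.sum_univ_two, Matrix.trace_fin_two, Matrix.single_apply] <;>
    ring

theorem depolarize_prodOp (r : ℝ) (A : ι → Matrix (Fin 2) (Fin 2) ℂ) :
    depolarize r (prodOp A) = prodOp fun i => depolarize₁ r (A i) := by
  ext s t
  simp only [depolarize, prodOp, ← Finset.prod_mul_distrib]
  rw [Finset.sum_congr rfl fun u _ => sum_pi_prod fun i k =>
      A i (u i) k * depolarize₁ r (Matrix.single (u i) k 1) (s i) (t i),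
    sum_pi_prod fun i j => ∑ k, A i j k * depolarize₁ r (Matrix.single j k 1) (s i) (t i)]
  exact Finset.prod_congr rfl fun i _ => (depolarize₁_eq_sum r (A i) (s i) (t i)).symm

theorem depolarize_sum {W : Type*} (r : ℝ) (F : Finset W) (c : W → ℂ) (ρ : W → Op ι) :
    depolarize r (∑ w ∈ F, c w • ρ w) = ∑ w ∈ F, c w • depolarize r (ρ w) := by
  ext s t
  simp only [depolarize, Matrix.sum_apply, Matrix.smul_apply, smul_eq_mul, Finset.sum_mul,
    Finset.mul_sum, mul_assoc]
  exact (Finset.sum_congr rfl fun u _ => Finset.sum_comm).trans Finset.sum_comm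

theorem depolarize_conjTranspose (r : ℝ) (ρ : Op ι) : (depolarize r ρ)ᴴ = depolarize r ρᴴ := by
  have key : ∀ u v a b : Fin 2, star (depolarize₁ r (Matrix.single u v 1) b a) =
      depolarize₁ r (Matrix.single v u 1) a b := by
    intro u v a b
    fin_cases u <;> fin_cases v <;> fin_cases a <;> fin_cases b <;>
      simp [depolarize₁, Matrix.trace]
  ext s t
  simp only [depolarize, Matrix.conjTranspose_apply, star_sum, star_mul', star_prod, key]
  rw [Finset.sum_comm]

theorem prod_glue (J : Finset ι) (A : ι → Matrix (Fin 2) (Fin 2) ℂ) (a b : J → Fin 2)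
    (c : ↥Jᶜ → Fin 2) :
    ∏ i, A i (glue J a c i) (glue J b c i) =
      (∏ i : J, A i (a i) (b i)) * ∏ i : ↥Jᶜ, A i (c i) (c i) := by
  rw [← Finset.prod_mul_prod_compl J, ← Finset.prod_coe_sort J, ← Finset.prod_coe_sort Jᶜ]
  congr 1
  · exact Finset.prod_congr rfl fun i _ => by simp [glue]
  · exact Finset.prod_congr rfl fun i _ => by
      have := Finset.mem_compl.1 i.2
      simp [glue, this]

/-- Every discarded qubit leaves only the scalar trace of its factor; this is the source of the
exponential decay of coherences. -/
theorem reduced_prodOp (J : Finset ι) (A : ι → Matrix (Fin 2) (Fin 2) ℂ) :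
    reduced J (prodOp A) = (∏ i : ↥Jᶜ, (A i).trace) • prodOp fun i : J => A i := by
  ext a b
  simp only [reduced, prodOp, prod_glue, Matrix.smul_apply, smul_eq_mul]
  rw [← Finset.mul_sum, mul_comm, sum_pi_prod fun (i : ↥Jᶜ) k => A i k k]
  rfl

theorem reduced_sum {W : Type*} (J : Finset ι) (F : Finset W) (c : W → ℂ) (ρ : W → Op ι) :
    reduced J (∑ w ∈ F, c w • ρ w) = ∑ w ∈ F, c w • reduced J (ρ w) := by
  ext a b
  simp only [reduced, Matrix.sum_apply, Matrix.smul_apply, smul_eq_mul, Finset.mul_sum]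
  rw [Finset.sum_comm]

theorem reduced_conjTranspose (J : Finset ι) (ρ : Op ι) : (reduced J ρ)ᴴ = reduced J ρᴴ := by
  ext a b
  simp [reduced, Matrix.conjTranspose_apply]

end Product

/-! ### Pauli spectra of stabilizer states -/

section PauliSpectrum
variable {ι : Type} [Fintype ι]

theorem pauli_completeness (a b c d : Fin 2) :
    ∑ q, pauli q a b * star (pauli q c d) = if a = c ∧ b = d then 2 else 0 := by
  fin_cases a <;> fin_cases b <;> fin_cases c <;> fin_cases d <;>
    simp [Fin.sum_univ_four, pauli] <;> norm_num

theorem trace_pauli_mul_pauli (q : Fin 4) : (pauli q * pauli q).trace = 2 := by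
  fin_cases q <;> simp [pauli, Matrix.trace_fin_two] <;> norm_num

theorem trace_pauli {q : Fin 4} (hq : q ≠ 0) : (pauli q).trace = 0 := by
  fin_cases q <;> simp [pauli, Matrix.trace_fin_two] at hq ⊢

theorem pauli_zero : pauli 0 = 1 := by
  ext a b; fin_cases a <;> fin_cases b <;> simp [pauli]

variable [DecidableEq ι]

theorem pauliString_completeness (a b c d : ι → Fin 2) :
    ∑ p : ι → Fin 4, pauliString p a b * star (pauliString p c d) =
      if a = c ∧ b = d then 2 ^ Fintype.card ι else 0 := by
  simp only [pauliString, star_prod, ← Finset.prod_mul_distrib]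
  rw [sum_pi_prod fun i q => pauli q (a i) (b i) * star (pauli q (c i) (d i))]
  simp only [pauli_completeness, Finset.prod_ite_zero, Finset.prod_const, Finset.card_univ,
    funext_iff, Finset.mem_univ, true_imp_iff, forall_and]

/-- Parseval for the orthogonal basis of Pauli strings, obtained from the completeness relation. -/
theorem sum_normSq_trace_pauliString (ρ : Op ι) :
    ∑ p : ι → Fin 4, ‖(pauliString p * ρ).trace‖ ^ 2 =
      2 ^ Fintype.card ι * ∑ a, ∑ b, ‖ρ a b‖ ^ 2 := by
  have key : ∑ p : ι → Fin 4, (pauliString p * ρ).trace * star (pauliString p * ρ).trace =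
      2 ^ Fintype.card ι * ∑ a, ∑ b, ρ a b * star (ρ a b) := by
    have h : ∀ p : ι → Fin 4, (pauliString p * ρ).trace * star (pauliString p * ρ).trace =
        ∑ x : (ι → Fin 2) × (ι → Fin 2), ∑ y : (ι → Fin 2) × (ι → Fin 2),
          (ρ x.2 x.1 * star (ρ y.2 y.1)) *
            (pauliString p x.1 x.2 * star (pauliString p y.1 y.2)) := by
      intro p
      simp only [Matrix.trace, Matrix.diag, Matrix.mul_apply, ← Finset.univ_product_univ,
        ← Finset.sum_product', star_sum, Finset.sum_mul_sum, star_mul']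
      exact Finset.sum_congr rfl fun x _ => by ring
    rw [Finset.sum_congr rfl fun p _ => h p, Finset.sum_comm]
    rw [Finset.sum_congr rfl fun x _ => Finset.sum_comm]
    simp only [← Finset.mul_sum, pauliString_completeness, ← Prod.ext_iff, mul_ite, mul_zero,
      Finset.sum_ite_eq, Finset.mem_univ, if_true]
    rw [Fintype.sum_prod_type_right, Finset.mul_sum]
    refine Finset.sum_congr rfl fun a _ => ?_
    rw [Finset.mul_sum]
    exact Finset.sum_congr rfl fun b _ => mul_comm _ _
  simp only [Complex.star_def, Complex.mul_conj, Complex.normSq_eq_norm_sq] at key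
  exact_mod_cast key

theorem sum_normSq_trace_proj {ψ : Ket ι} (h : ∑ s, ‖ψ s‖ ^ 2 = 1) :
    ∑ p : ι → Fin 4, ‖(pauliString p * proj ψ).trace‖ ^ 2 = 2 ^ Fintype.card ι := by
  rw [sum_normSq_trace_pauliString]
  simp only [proj, vecMulVec_apply, Pi.star_apply, norm_mul, norm_star, mul_pow]
  simp [← Finset.mul_sum, h]

theorem trace_proj {ψ : Ket ι} (h : ∑ s, ‖ψ s‖ ^ 2 = 1) : (proj ψ).trace = 1 := by
  simp only [proj, Matrix.trace, Matrix.diag, vecMulVec_apply, Pi.star_apply, Complex.star_def,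
    Complex.mul_conj, Complex.normSq_eq_norm_sq]
  exact_mod_cast h

/-- The Pauli strings that stabilize `ψ` up to a phase. -/
noncomputable def stabilizingStrings (ψ : Ket ι) : Finset (ι → Fin 4) :=
  Finset.univ.filter fun p => ‖(pauliString p * proj ψ).trace‖ = 1

/-- The phase of a stabilizing element is forced by its string: if `c • P` fixes `ψ`, taking traces
against `proj ψ` gives `c * tr (P * proj ψ) = 1`. Counting group elements thus reduces to counting
strings. -/
theorem stabilizer_subset {ψ : Ket ι} (h : ∑ s, ‖ψ s‖ ^ 2 = 1) :
    {M | M ∈ pauliGroup ι ∧ M *ᵥ ψ = ψ} ⊆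
      (fun p => (pauliString p * proj ψ).trace⁻¹ • pauliString p) ''
        (stabilizingStrings ψ : Set (ι → Fin 4)) := by
  rintro _ ⟨⟨k, p, rfl⟩, hM⟩
  have h1 : Complex.I ^ (k : ℕ) * (pauliString p * proj ψ).trace = 1 := by
    rw [← trace_proj h, ← smul_eq_mul, ← Matrix.trace_smul, ← Matrix.smul_mul, proj,
      Matrix.mul_vecMulVec, hM]
  refine ⟨p, ?_, ?_⟩
  · have := congrArg norm h1
    simpa [stabilizingStrings] using this
  · simp only
    rw [← eq_inv_of_mul_eq_one_left h1]

theorem card_stabilizingStrings_le {ψ : Ket ι} (h : ∑ s, ‖ψ s‖ ^ 2 = 1) :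
    (stabilizingStrings ψ).card ≤ 2 ^ Fintype.card ι := by
  have h2 : ((stabilizingStrings ψ).card : ℝ) ≤ 2 ^ Fintype.card ι := by
    rw [← sum_normSq_trace_proj h]
    calc ((stabilizingStrings ψ).card : ℝ)
        = ∑ p ∈ stabilizingStrings ψ, ‖(pauliString p * proj ψ).trace‖ ^ 2 := by
          rw [Finset.sum_congr rfl fun p hp => by rw [(Finset.mem_filter.1 hp).2, one_pow]]
          simp
      _ ≤ _ := Finset.sum_le_sum_of_subset_of_nonneg (Finset.subset_univ _)
          fun _ _ _ => by positivity
  exact_mod_cast h2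

theorem ncard_stabilizer_le_card {ψ : Ket ι} (h : ∑ s, ‖ψ s‖ ^ 2 = 1) :
    {M | M ∈ pauliGroup ι ∧ M *ᵥ ψ = ψ}.ncard ≤ (stabilizingStrings ψ).card := by
  refine (Set.ncard_le_ncard (stabilizer_subset h) ((Finset.finite_toSet _).image _)).trans ?_
  refine (Set.ncard_image_le (Finset.finite_toSet _)).trans ?_
  rw [Set.ncard_coe_finset]

theorem finite_stabilizer {ψ : Ket ι} (h : ∑ s, ‖ψ s‖ ^ 2 = 1) :
    {M | M ∈ pauliGroup ι ∧ M *ᵥ ψ = ψ}.Finite :=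
  ((Finset.finite_toSet _).image _).subset (stabilizer_subset h)

/-- The Pauli spectrum of a stabilizer state has `ℓ¹`-norm at most `2 ^ n`. -/
theorem IsStabilizerKet.sum_norm_trace_le {ψ : Ket ι} (h : IsStabilizerKet ψ) :
    ∑ p : ι → Fin 4, ‖(pauliString p * proj ψ).trace‖ ≤ 2 ^ Fintype.card ι := by
  have hcard : (2 : ℝ) ^ Fintype.card ι ≤ (stabilizingStrings ψ).card := by
    have := ncard_stabilizer_le_card h.unit
    rw [h.card_stabilizer] at this
    exact_mod_cast this
  have hs := sum_normSq_trace_proj h.unit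
  rw [← Finset.sum_add_sum_compl (stabilizingStrings ψ)] at hs ⊢
  have h1 : ∀ p ∈ stabilizingStrings ψ, ‖(pauliString p * proj ψ).trace‖ = 1 :=
    fun p hp => (Finset.mem_filter.1 hp).2
  rw [Finset.sum_congr rfl fun p hp => by rw [h1 p hp, one_pow]] at hs
  rw [Finset.sum_congr rfl h1]
  simp only [Finset.sum_const, nsmul_eq_mul, mul_one] at hs ⊢
  -- The stabilizing strings, at least `2 ^ n` of them with modulus 1, already exhaust the Parseval
  -- total `2 ^ n`, so all other expectations vanish.
  have h0 : ∑ p ∈ (stabilizingStrings ψ)ᶜ, ‖(pauliString p * proj ψ).trace‖ ^ 2 = 0 :=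
    le_antisymm (by linarith) (Finset.sum_nonneg fun _ _ => by positivity)
  have h2 := (Finset.sum_eq_zero_iff_of_nonneg fun _ _ => by positivity).1 h0
  rw [Finset.sum_eq_zero fun p hp => pow_eq_zero_iff two_ne_zero |>.1 (h2 p hp)]
  linarith

/-- The `ℓ¹`-norm of the Pauli spectrum. -/
noncomputable def pauliNorm (ρ : Op ι) : ℝ := ∑ p : ι → Fin 4, ‖(pauliString p * ρ).trace‖

theorem pauliNorm_add_le (ρ σ : Op ι) : pauliNorm (ρ + σ) ≤ pauliNorm ρ + pauliNorm σ := by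
  simp only [pauliNorm, ← Finset.sum_add_distrib, Matrix.mul_add, Matrix.trace_add]
  exact Finset.sum_le_sum fun p _ => norm_add_le _ _

theorem pauliNorm_smul (a : ℝ) (ρ : Op ι) : pauliNorm (a • ρ) = |a| * pauliNorm ρ := by
  simp [pauliNorm, Finset.mul_sum]

theorem convexOn_pauliNorm : ConvexOn ℝ Set.univ (pauliNorm (ι := ι)) := by
  refine ⟨convex_univ, fun ρ _ σ _ a b ha hb _ => ?_⟩
  refine (pauliNorm_add_le _ _).trans ?_
  rw [pauliNorm_smul, pauliNorm_smul, abs_of_nonneg ha, abs_of_nonneg hb, smul_eq_mul, smul_eq_mul]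

theorem pauliNorm_le_of_mem_STAB {ρ : Op ι} (h : ρ ∈ STAB ι) :
    pauliNorm ρ ≤ 2 ^ Fintype.card ι := by
  have : STAB ι ⊆ {ρ ∈ Set.univ | pauliNorm ρ ≤ 2 ^ Fintype.card ι} := by
    refine convexHull_min ?_ (convexOn_pauliNorm.convex_le _)
    rintro _ ⟨ψ, hψ, rfl⟩
    exact ⟨trivial, hψ.sum_norm_trace_le⟩
  exact (this h).2

/-! ### Robustness and its Pauli-norm lower bound -/

/-- The set whose infimum is the robustness of magic. -/
def robustnessSet (ρ : Op ι) : Set ℝ :=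
  {r | ∃ a : ℝ, 0 ≤ a ∧ ∃ σ ∈ STAB ι, ∃ τ ∈ STAB ι, ρ = (a + 1) • σ - a • τ ∧ r = 2 * a + 1}

theorem one_le_of_mem_robustnessSet {ρ : Op ι} {r : ℝ} (h : r ∈ robustnessSet ρ) : 1 ≤ r := by
  obtain ⟨a, ha, -, -, -, -, -, rfl⟩ := h
  linarith

/-- Triangle inequality on `(a + 1) • σ - a • τ`, whose two weights sum to `2 * a + 1`. Nonemptiness
matters because `sInf ∅ = 0` in `ℝ`. -/
theorem pauliNorm_le_RoM {ρ : Op ι} (h : (robustnessSet ρ).Nonempty) :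
    pauliNorm ρ ≤ 2 ^ Fintype.card ι * RoM ρ := by
  rw [← div_le_iff₀' (by positivity)]
  refine le_csInf h ?_
  rintro _ ⟨a, ha, σ, hσ, τ, hτ, rfl, rfl⟩
  rw [div_le_iff₀' (by positivity), sub_eq_add_neg, ← neg_smul]
  refine (pauliNorm_add_le _ _).trans ?_
  rw [pauliNorm_smul, pauliNorm_smul, abs_of_nonneg (by linarith), abs_neg, abs_of_nonneg ha]
  have h1 := mul_le_mul_of_nonneg_left (pauliNorm_le_of_mem_STAB hσ) (by linarith : 0 ≤ a + 1)
  have h2 := mul_le_mul_of_nonneg_left (pauliNorm_le_of_mem_STAB hτ) ha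
  linarith

theorem RoM_le_of_mem {ρ : Op ι} {r : ℝ} (h : r ∈ robustnessSet ρ) : RoM ρ ≤ r :=
  csInf_le ⟨1, fun _ => one_le_of_mem_robustnessSet⟩ h

theorem one_le_RoM {ρ : Op ι} (h : (robustnessSet ρ).Nonempty) : 1 ≤ RoM ρ :=
  le_csInf h fun _ => one_le_of_mem_robustnessSet

theorem RoM_le_one_of_mem_STAB {ρ : Op ι} (h : ρ ∈ STAB ι) : RoM ρ ≤ 1 :=
  RoM_le_of_mem ⟨0, le_rfl, ρ, h, ρ, h, by simp, by simp⟩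

end PauliSpectrum

/-! ### The six single-qubit stabilizer states -/

/-- The single-qubit state `(|0⟩ + iʳ|1⟩) / √2`. -/
noncomputable def equatorVec (r : Fin 4) : Fin 2 → ℂ :=
  ![((√2 : ℝ) : ℂ)⁻¹, ((√2 : ℝ) : ℂ)⁻¹ * Complex.I ^ (r : ℕ)]

/-- The six single-qubit stabilizer states: four on the equator, and the computational basis. -/
noncomputable def stabVec : Fin 4 ⊕ Fin 2 → Fin 2 → ℂ := Sum.elim equatorVec fun b => Pi.single b 1

/-- The Pauli matrix that stabilizes `stabVec w` up to sign. -/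
def stabAxis : Fin 4 ⊕ Fin 2 → Fin 4 := Sum.elim ![1, 2, 1, 2] fun _ => 3

/-- The eigenvalue of `stabVec w` under its Pauli matrix. -/
def stabSign : Fin 4 ⊕ Fin 2 → ℂ := Sum.elim ![1, 1, -1, -1] ![1, -1]

/-- The projectors onto the six single-qubit stabilizer states. -/
noncomputable def stabProj : Fin 4 ⊕ Fin 2 → Matrix (Fin 2) (Fin 2) ℂ :=
  Sum.elim (fun r => !![1 / 2, (-Complex.I) ^ (r : ℕ) / 2; Complex.I ^ (r : ℕ) / 2, 1 / 2])
    fun b => Matrix.single b b 1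

theorem inv_sqrt_two_mul_self : ((√2 : ℝ) : ℂ)⁻¹ * ((√2 : ℝ) : ℂ)⁻¹ = 1 / 2 := by
  rw [← mul_inv, ← Complex.ofReal_mul, Real.mul_self_sqrt (by norm_num)]
  norm_num

theorem equatorVec_outer (r r' : Fin 4) :
    vecMulVec (equatorVec r) (star (equatorVec r')) =
      !![1 / 2, (-Complex.I) ^ (r' : ℕ) / 2;
        Complex.I ^ (r : ℕ) / 2, Complex.I ^ (r : ℕ) * (-Complex.I) ^ (r' : ℕ) / 2] := by
  ext a b
  have h := inv_sqrt_two_mul_self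
  fin_cases a <;> fin_cases b <;>
    simp only [equatorVec, vecMulVec_apply, Pi.star_apply, Complex.star_def, Fin.zero_eta,
      Fin.mk_one, Matrix.cons_val_zero, Matrix.cons_val_one, Matrix.of_apply, map_mul, map_pow,
      map_inv₀, Complex.conj_ofReal, Complex.conj_I]
  · linear_combination h
  · linear_combination (-Complex.I) ^ (r' : ℕ) * h
  · linear_combination Complex.I ^ (r : ℕ) * h
  · linear_combination Complex.I ^ (r : ℕ) * (-Complex.I) ^ (r' : ℕ) * h

theorem stabVec_outer (w : Fin 4 ⊕ Fin 2) :
    vecMulVec (stabVec w) (star (stabVec w)) = stabProj w := by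
  rcases w with r | b
  · simp only [stabVec, stabProj, Sum.elim_inl, equatorVec_outer, ← mul_pow]
    simp
  · ext c d
    fin_cases b <;> fin_cases c <;> fin_cases d <;> simp [stabVec, stabProj, vecMulVec_apply]

theorem trace_stabProj (w : Fin 4 ⊕ Fin 2) : (stabProj w).trace = 1 := by
  rcases w with r | b
  · simp [stabProj, Matrix.trace_fin_two]
    norm_num
  · simp [stabProj]

theorem stabProj_conjTranspose (w : Fin 4 ⊕ Fin 2) : (stabProj w)ᴴ = stabProj w := by
  rw [← stabVec_outer, conjTranspose_vecMulVec, star_star]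

theorem norm_stabVec (w : Fin 4 ⊕ Fin 2) : ∑ a, ‖stabVec w a‖ ^ 2 = 1 := by
  have h := trace_stabProj w
  rw [← stabVec_outer] at h
  simp only [Matrix.trace, Matrix.diag, vecMulVec_apply, Pi.star_apply, Complex.star_def,
    Complex.mul_conj, Complex.normSq_eq_norm_sq] at h
  exact_mod_cast h

theorem pauli_mulVec_stabVec (w : Fin 4 ⊕ Fin 2) :
    (stabSign w • pauli (stabAxis w)) *ᵥ stabVec w = stabVec w := by
  rcases w with r | b
  · ext a
    fin_cases r <;> fin_cases a <;>
      simp [stabSign, stabAxis, stabVec, equatorVec, pauli, Matrix.mulVec, dotProduct,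
        Fin.sum_univ_two, pow_succ] <;> ring_nf <;> simp
  · ext a
    fin_cases b <;> fin_cases a <;>
      simp [stabSign, stabAxis, stabVec, pauli, Matrix.mulVec, dotProduct,
        Fin.sum_univ_two]

theorem stabSign_eq (w : Fin 4 ⊕ Fin 2) : stabSign w = 1 ∨ stabSign w = -1 := by
  rcases w with r | b
  · fin_cases r <;> simp [stabSign]
  · fin_cases b <;> simp [stabSign]

theorem stabAxis_ne_zero (w : Fin 4 ⊕ Fin 2) : stabAxis w ≠ 0 := by
  rcases w with r | b
  · fin_cases r <;> simp [stabAxis]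
  · simp [stabAxis]

/-- The two Pauli matrices that stabilize `stabVec w`. -/
noncomputable def stabilizerOf (w : Fin 4 ⊕ Fin 2) (g : Fin 2) : Matrix (Fin 2) (Fin 2) ℂ :=
  if g = 0 then 1 else stabSign w • pauli (stabAxis w)

theorem stabilizerOf_mulVec (w : Fin 4 ⊕ Fin 2) (g : Fin 2) :
    stabilizerOf w g *ᵥ stabVec w = stabVec w := by
  unfold stabilizerOf
  split_ifs
  · exact Matrix.one_mulVec _
  · exact pauli_mulVec_stabVec w

theorem trace_stabilizerOf_mul (w : Fin 4 ⊕ Fin 2) (g h : Fin 2) :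
    (stabilizerOf w g * stabilizerOf w h).trace = if g = h then 2 else 0 := by
  have h1 : stabSign w * stabSign w = 1 := by rcases stabSign_eq w with h | h <;> simp [h]
  have h2 := trace_pauli (stabAxis_ne_zero w)
  have h3 := trace_pauli_mul_pauli (stabAxis w)
  fin_cases g <;> fin_cases h <;> simp [stabilizerOf, h2, h3, ← mul_assoc, h1]

theorem stabilizerOf_eq (w : Fin 4 ⊕ Fin 2) (g : Fin 2) :
    ∃ (e : ℕ) (q : Fin 4), stabilizerOf w g = (-1 : ℂ) ^ e • pauli q := by
  unfold stabilizerOf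
  split_ifs
  · exact ⟨0, 0, by simp [pauli_zero]⟩
  · rcases stabSign_eq w with h | h
    · exact ⟨0, stabAxis w, by simp [h]⟩
    · exact ⟨1, stabAxis w, by simp [h]⟩

/-! ### Product stabilizer states and expansions in them -/

section
variable {ι : Type} [Fintype ι]

theorem prodOp_stabilizerOf_mem (w : ι → Fin 4 ⊕ Fin 2) (g : ι → Fin 2) :
    prodOp (fun i => stabilizerOf (w i) (g i)) ∈ pauliGroup ι := by
  choose e q h using fun i => stabilizerOf_eq (w i) (g i)
  simp only [h, prodOp_smul, Finset.prod_pow_eq_pow_sum]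
  rcases neg_one_pow_eq_or ℂ (∑ i, e i) with h | h
  · exact ⟨0, q, by simp [h, pauliString_eq_prodOp]⟩
  · exact ⟨2, q, by simp [h, pauliString_eq_prodOp]⟩

variable [DecidableEq ι]

/-- Choosing the identity or the signed Pauli on each qubit gives `2 ^ n` stabilizing elements,
distinct by trace orthogonality; Parseval allows no more. -/
theorem isStabilizerKet_prodKet (w : ι → Fin 4 ⊕ Fin 2) :
    IsStabilizerKet (prodKet fun i => stabVec (w i)) := by
  have hu : ∑ s, ‖prodKet (fun i => stabVec (w i)) s‖ ^ 2 = 1 := by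
    simp only [prodKet, norm_prod, ← Finset.prod_pow]
    rw [sum_pi_prod fun i a => ‖stabVec (w i) a‖ ^ 2]
    simp only [norm_stabVec, Finset.prod_const_one]
  refine ⟨hu, le_antisymm
    ((ncard_stabilizer_le_card hu).trans (card_stabilizingStrings_le hu)) ?_⟩
  let F : (ι → Fin 2) → Op ι := fun g => prodOp fun i => stabilizerOf (w i) (g i)
  have hF : Function.Injective F := by
    intro g h hgh
    by_contra hne
    obtain ⟨i, hi⟩ := Function.ne_iff.1 hne
    have h1 : (F g * F g).trace = (F g * F h).trace := by rw [hgh]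
    simp only [F, prodOp_mul, trace_prodOp, trace_stabilizerOf_mul] at h1
    have h2 : ∏ i, (if g i = h i then (2 : ℂ) else 0) = 0 :=
      Finset.prod_eq_zero (Finset.mem_univ i) (if_neg hi)
    rw [h2] at h1
    simp at h1
  calc 2 ^ Fintype.card ι = (Set.range F).ncard := by
        rw [← Set.image_univ, Set.ncard_image_of_injective _ hF, Set.ncard_univ,
          Nat.card_eq_fintype_card]
        simp
    _ ≤ _ := by
        refine Set.ncard_le_ncard ?_ (finite_stabilizer hu)
        rintro _ ⟨g, rfl⟩
        refine ⟨prodOp_stabilizerOf_mem w g, ?_⟩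
        simp only [F, prodOp_mulVec, stabilizerOf_mulVec]

theorem prodOp_stabProj_mem_STAB (w : ι → Fin 4 ⊕ Fin 2) :
    prodOp (fun i => stabProj (w i)) ∈ STAB ι :=
  subset_convexHull ℝ _ ⟨_, isStabilizerKet_prodKet w, by simp only [proj_prodKet, stabVec_outer]⟩

theorem trace_prodOp_stabProj (w : ι → Fin 4 ⊕ Fin 2) :
    (prodOp fun i => stabProj (w i)).trace = 1 := by
  simp [trace_prodOp, trace_stabProj]

/-- In a decomposition of a Hermitian operator into product stabilizer states, the imaginary parts
of the coefficients cancel. -/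
theorem eq_sum_re_of_isHermitian {ρ : Op ι} (hρ : ρᴴ = ρ) {z : (ι → Fin 4 ⊕ Fin 2) → ℂ}
    (h : ρ = ∑ w, z w • prodOp fun i => stabProj (w i)) :
    ρ = ∑ w, (z w).re • prodOp fun i => stabProj (w i) := by
  have h2 : ρ = ∑ w, star (z w) • prodOp fun i => stabProj (w i) := by
    conv_lhs => rw [← hρ, h]
    simp only [conjTranspose_sum, conjTranspose_smul, prodOp_conjTranspose, stabProj_conjTranspose]
  have h3 : ρ = (1 / 2 : ℂ) • (ρ + ρ) := by module
  rw [h3]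
  nth_rw 1 [h]
  rw [h2, ← Finset.sum_add_distrib, Finset.smul_sum]
  refine Finset.sum_congr rfl fun w _ => ?_
  rw [← add_smul, smul_smul, ← Complex.coe_smul, Complex.re_eq_add_conj, Complex.star_def]
  congr 1
  ring

theorem sum_coeff_eq_trace {ρ : Op ι} {q : (ι → Fin 4 ⊕ Fin 2) → ℝ}
    (h : ρ = ∑ w, q w • prodOp fun i => stabProj (w i)) : ((∑ w, q w : ℝ) : ℂ) = ρ.trace := by
  rw [h, Matrix.trace_sum]
  simp [trace_prodOp_stabProj]

theorem mem_STAB_of_nonneg {ρ : Op ι} {q : (ι → Fin 4 ⊕ Fin 2) → ℝ}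
    (h : ρ = ∑ w, q w • prodOp fun i => stabProj (w i)) (hq : ∀ w, 0 ≤ q w) (htr : ρ.trace = 1) :
    ρ ∈ STAB ι := by
  have h1 := sum_coeff_eq_trace h
  rw [htr] at h1
  rw [h]
  exact (convex_convexHull ℝ _).sum_mem (fun w _ => hq w) (by exact_mod_cast h1)
    fun w _ => prodOp_stabProj_mem_STAB w

/-- The coefficients of a matrix unit with respect to the stabilizer projectors. -/
noncomputable def unitCoeff (a b : Fin 2) : Fin 4 ⊕ Fin 2 → ℂ :=
  if a = b then Sum.elim 0 (Pi.single a 1)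
  else if a = 0 then Sum.elim ![1 / 2, Complex.I / 2, -1 / 2, -Complex.I / 2] 0
  else Sum.elim ![1 / 2, -Complex.I / 2, -1 / 2, Complex.I / 2] 0

theorem single_eq_sum_stabProj (a b : Fin 2) :
    Matrix.single a b 1 = ∑ w, unitCoeff a b w • stabProj w := by
  ext c d
  fin_cases a <;> fin_cases b <;> fin_cases c <;> fin_cases d <;>
    simp [unitCoeff, stabProj, Fintype.sum_sum_type, Fin.sum_univ_four, Fin.sum_univ_two,
      Matrix.sum_apply, pow_succ] <;> ring_nf <;> simp <;> norm_num

theorem norm_unitCoeff_le (a b : Fin 2) (w : Fin 4 ⊕ Fin 2) : ‖unitCoeff a b w‖ ≤ 1 := by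
  rcases w with r | c
  · fin_cases a <;> fin_cases b <;> fin_cases r <;> simp [unitCoeff] <;> norm_num
  · fin_cases a <;> fin_cases b <;> fin_cases c <;> simp [unitCoeff]

/-- Each of the `4 ^ n` matrix units is a product of single-qubit units, hence a combination of
product projectors with coefficients of modulus at most 1; each contributes at most `δ` to a given
coefficient. -/
theorem exists_coeff {Δ : Op ι} (hΔ : Δᴴ = Δ) {δ : ℝ} (hδ : ∀ a b, ‖Δ a b‖ ≤ δ) :
    ∃ q : (ι → Fin 4 ⊕ Fin 2) → ℝ, Δ = ∑ w, q w • prodOp (fun i => stabProj (w i)) ∧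
      ∀ w, |q w| ≤ 4 ^ Fintype.card ι * δ := by
  refine ⟨fun w => (∑ a, ∑ b, Δ a b * ∏ i, unitCoeff (a i) (b i) (w i)).re,
    eq_sum_re_of_isHermitian hΔ ?_, fun w => ?_⟩
  · have h : ∀ a b : ι → Fin 2, Matrix.single a b (1 : ℂ) =
        ∑ w : ι → Fin 4 ⊕ Fin 2, (∏ i, unitCoeff (a i) (b i) (w i)) •
          prodOp fun i => stabProj (w i) := by
      intro a b
      trans prodOp fun i => Matrix.single (a i) (b i) 1
      · ext s t
        simp only [prodOp, Matrix.single_apply, Finset.prod_ite_zero, Finset.mem_univ,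
          true_imp_iff, forall_and, Finset.prod_const_one, funext_iff]
      · ext s t
        simp only [single_eq_sum_stabProj, prodOp, Matrix.sum_apply, Matrix.smul_apply,
          smul_eq_mul, ← Finset.prod_mul_distrib]
        exact (sum_pi_prod fun i w => unitCoeff (a i) (b i) w * stabProj w (s i) (t i)).symm
    conv_lhs => rw [Matrix.matrix_eq_sum_single Δ]
    have h' : ∀ a b : ι → Fin 2, Matrix.single a b (Δ a b) =
        ∑ w : ι → Fin 4 ⊕ Fin 2, (Δ a b * ∏ i, unitCoeff (a i) (b i) (w i)) •
          prodOp fun i => stabProj (w i) := by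
      intro a b
      rw [← mul_one (Δ a b), ← smul_eq_mul, ← Matrix.smul_single, h, Finset.smul_sum]
      simp only [smul_smul, smul_eq_mul, mul_one]
    simp only [h', Finset.sum_smul]
    rw [Finset.sum_congr rfl fun a _ => Finset.sum_comm, Finset.sum_comm]
  · refine (Complex.abs_re_le_norm _).trans ?_
    refine (norm_sum_le _ _).trans ?_
    have h1 : ∀ a b : ι → Fin 2, ‖Δ a b * ∏ i, unitCoeff (a i) (b i) (w i)‖ ≤ δ := fun a b => by
      rw [norm_mul, norm_prod]
      exact (mul_le_of_le_one_right (norm_nonneg _) (Finset.prod_le_one (fun _ _ => norm_nonneg _)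
        fun _ _ => norm_unitCoeff_le _ _ _)).trans (hδ a b)
    refine (Finset.sum_le_sum fun a _ => (norm_sum_le _ _).trans
      (Finset.sum_le_sum fun b _ => h1 a b)).trans ?_
    simp only [Finset.sum_const, Finset.card_univ, Fintype.card_fun, Fintype.card_fin, nsmul_eq_mul]
    rw [← mul_assoc, ← Nat.cast_mul, ← mul_pow]
    norm_num

/-- The robustness of magic of a state that is entrywise close to a stabilizer state. -/
theorem mem_robustnessSet_of_close {ρ σ : Op ι} (hρ : ρᴴ = ρ) (hσ : σᴴ = σ) (hmem : σ ∈ STAB ι)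
    (htr : ρ.trace = σ.trace) {δ : ℝ} (hδ : ∀ a b, ‖ρ a b - σ a b‖ ≤ δ) :
    ∃ r ∈ robustnessSet ρ, r ≤ 1 + 2 * 24 ^ Fintype.card ι * δ := by
  obtain ⟨q, hq, hqδ⟩ := exists_coeff (Δ := ρ - σ) (by rw [conjTranspose_sub, hρ, hσ]) hδ
  have h0 : ∑ w, q w = 0 := by
    have := sum_coeff_eq_trace hq
    rw [Matrix.trace_sub, htr, sub_self] at this
    exact_mod_cast this
  -- The difference `ρ - σ` has trace zero, so the positive and negative parts of its coefficients
  -- carry the same mass `a`.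
  set a := ∑ w, (q w)⁺ with ha
  have ha' : ∑ w, (q w)⁻ = a := by
    have : ∑ w, ((q w)⁺ - (q w)⁻) = 0 := by simpa only [posPart_sub_negPart] using h0
    rw [Finset.sum_sub_distrib] at this
    linarith
  have ha0 : 0 ≤ a := Finset.sum_nonneg fun w _ => posPart_nonneg _
  have hbound : a ≤ 24 ^ Fintype.card ι * δ := by
    -- There are `6 ^ n` product projectors with coefficients at most `4 ^ n * δ`, whence `24 ^ n`.
    calc a ≤ ∑ w : ι → Fin 4 ⊕ Fin 2, 4 ^ Fintype.card ι * δ :=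
          Finset.sum_le_sum fun w _ => (sup_le (le_abs_self _) (abs_nonneg _)).trans (hqδ w)
      _ = _ := by
          simp only [Finset.sum_const, Finset.card_univ, Fintype.card_fun, Fintype.card_sum,
            Fintype.card_fin, nsmul_eq_mul]
          rw [← mul_assoc]
          push_cast
          rw [← mul_pow]
          norm_num
  refine ⟨2 * a + 1, ?_, by linarith⟩
  have hconv : Convex ℝ (STAB ι) := convex_convexHull ℝ _
  rcases ha0.eq_or_lt with h | hpos
  · have hz : ∀ w, q w = 0 := fun w => by
      have h1 := (Finset.sum_eq_zero_iff_of_nonneg fun w _ => posPart_nonneg (q w)).1 h.symm w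
        (Finset.mem_univ w)
      have h2 := (Finset.sum_eq_zero_iff_of_nonneg fun w _ => negPart_nonneg (q w)).1
        (ha'.trans h.symm) w (Finset.mem_univ w)
      rw [← posPart_sub_negPart (q w), h1, h2, sub_zero]
    refine ⟨a, ha0, σ, hmem, σ, hmem, ?_, rfl⟩
    simp only [hz, zero_smul, Finset.sum_const_zero, sub_eq_zero] at hq
    rw [hq]
    module
  · let P : (ι → Fin 4 ⊕ Fin 2) → Op ι := fun w => prodOp fun i => stabProj (w i)
    have hmix : ∀ c : (ι → Fin 4 ⊕ Fin 2) → ℝ, (∀ w, 0 ≤ c w) → ∑ w, c w = a →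
        a⁻¹ • ∑ w, c w • P w ∈ STAB ι := fun c hc hca => by
      rw [Finset.smul_sum]
      simp only [smul_smul]
      refine hconv.sum_mem (fun w _ => mul_nonneg (inv_nonneg.2 ha0) (hc w)) ?_
        fun w _ => prodOp_stabProj_mem_STAB w
      rw [← Finset.mul_sum, hca, inv_mul_cancel₀ hpos.ne']
    have h1 := hmix _ (fun w => posPart_nonneg _) ha.symm
    have h2 := hmix _ (fun w => negPart_nonneg _) ha'
    -- The positive state is `σ` mixed with the normalized positive part in proportion 1 : `a`; the
    -- negative state is the normalized negative part.
    have h3 := hconv hmem h1 (a := (a + 1)⁻¹) (b := (a + 1)⁻¹ * a) (by positivity) (by positivity)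
      (by field_simp; ring)
    refine ⟨a, ha0, _, h3, _, h2, ?_, rfl⟩
    have h4 : ρ = σ + (∑ w, (q w)⁺ • P w - ∑ w, (q w)⁻ • P w) := by
      rw [← Finset.sum_sub_distrib]
      simp only [← sub_smul, posPart_sub_negPart]
      rw [← hq]
      abel
    rw [smul_add, smul_smul, smul_smul, ← mul_assoc, mul_inv_cancel₀ (by positivity : a + 1 ≠ 0),
      one_smul, one_mul, smul_smul, mul_inv_cancel₀ hpos.ne', smul_smul,
      mul_inv_cancel₀ hpos.ne', one_smul, one_smul, h4]
    abel

theorem isHermitian_of_mem_STAB {σ : Op ι} (h : σ ∈ STAB ι) : σᴴ = σ ∧ σ.trace = 1 := by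
  have : STAB ι ⊆ {σ | σᴴ = σ ∧ σ.trace = 1} := by
    refine convexHull_min ?_ ?_
    · rintro _ ⟨ψ, hψ, rfl⟩
      exact ⟨proj_conjTranspose ψ, trace_proj hψ.unit⟩
    · rintro ρ ⟨h1, h2⟩ σ ⟨h3, h4⟩ a b ha hb hab
      refine ⟨by simp [conjTranspose_add, conjTranspose_smul, h1, h3], ?_⟩
      rw [Matrix.trace_add, Matrix.trace_smul, Matrix.trace_smul, h2, h4, ← add_smul, hab, one_smul]
  exact this h

/-- Comparison with `|0…0⟩⟨0…0|`, with a crude `δ` that need not be small. -/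
theorem robustnessSet_nonempty {ρ : Op ι} (hρ : ρᴴ = ρ) (htr : ρ.trace = 1) :
    (robustnessSet ρ).Nonempty := by
  have hσ := prodOp_stabProj_mem_STAB fun _ : ι => Sum.inr 0
  obtain ⟨h1, h2⟩ := isHermitian_of_mem_STAB hσ
  obtain ⟨r, hr, -⟩ := mem_robustnessSet_of_close hρ h1 hσ (htr.trans h2.symm)
    (δ := ∑ a, ∑ b, ‖ρ a b - prodOp (fun _ : ι => stabProj (Sum.inr 0)) a b‖)
    fun a b => (Finset.single_le_sum (f := fun b => ‖ρ a b - prodOp _ a b‖)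
      (fun _ _ => norm_nonneg _) (Finset.mem_univ b)).trans
      (Finset.single_le_sum (f := fun a => ∑ b, ‖ρ a b - prodOp _ a b‖)
        (fun _ _ => by positivity) (Finset.mem_univ a))
  exact ⟨r, hr⟩

end

/-! ### Binomial signs as characters of ℤ/4 -/

section Phases

/-- By Vandermonde, since `Nat.choose 4 j` is even for `j = 1, 2, 3`. -/
theorem periodic_neg_one_pow_choose {d : ℕ} (hd : d ≤ 3) :
    Function.Periodic (fun w : ℕ => (-1 : ℂ) ^ w.choose d) 4 := by
  intro w
  have h : ∃ k, (w + 4).choose d = w.choose d + 2 * k := by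
    interval_cases d
    · exact ⟨0, by simp⟩
    · exact ⟨2, by simp⟩
    · exact ⟨2 * w + 3, by simp [Nat.choose_succ_succ]; ring⟩
    · exact ⟨2 * w.choose 2 + 3 * w + 2, by simp [Nat.choose_succ_succ]; ring⟩
  obtain ⟨k, hk⟩ := h
  simp [hk, pow_add, pow_mul]

theorem periodic_pow {z : ℂ} (hz : z ^ 4 = 1) : Function.Periodic (fun w : ℕ => z ^ w) 4 :=
  fun w => by simp [pow_add, hz]

theorem I_pow_pow_four (r : ℕ) : (Complex.I ^ r) ^ 4 = 1 := by
  rw [← pow_mul, mul_comm, pow_mul, Complex.I_pow_four, one_pow]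

theorem neg_I_pow_pow_four (r : ℕ) : ((-Complex.I) ^ r) ^ 4 = 1 := by
  rw [← pow_mul, mul_comm, pow_mul, neg_pow, Complex.I_pow_four]
  norm_num

/-- The amplitudes of the `3`-complete hypergraph state on four product states. -/
noncomputable def gammaCoeff : Fin 4 → ℂ := ![1, -Complex.I, 1, Complex.I]

/-- The discrete Fourier expansion of the period-4 sequence 1, 1, 1, -1. -/
theorem neg_one_pow_choose_three (w : ℕ) :
    (-1 : ℂ) ^ w.choose 3 = (1 / 2) * ∑ r : Fin 4, gammaCoeff r * (Complex.I ^ (r : ℕ)) ^ w := by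
  have h4 : w % 4 < 4 := Nat.mod_lt _ (by norm_num)
  rw [← (periodic_neg_one_pow_choose le_rfl).map_mod_nat w]
  simp only [← (periodic_pow (I_pow_pow_four _)).map_mod_nat w]
  interval_cases w % 4 <;>
    simp [Fin.sum_univ_four, gammaCoeff, ← pow_mul, Nat.choose] <;> ring_nf

/-- Both sides are 4 if `m ≡ k` mod 4 and 0 otherwise: the parities of `choose 1` and `choose 2` are
the two binary digits mod 4, and the `choose 3` signs then cancel. Expanding the two brackets yields
the four hypergraph states of `fourMixture`. -/
theorem sum_I_pow_eq (m k : ℕ) :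
    ∑ r : Fin 4, (Complex.I ^ (r : ℕ)) ^ m * ((-Complex.I) ^ (r : ℕ)) ^ k =
      (-1) ^ m.choose 3 * (-1) ^ k.choose 3 * (1 + (-1) ^ m.choose 2 * (-1) ^ k.choose 2) *
        (1 + (-1) ^ m.choose 1 * (-1) ^ k.choose 1) := by
  have h4 : m % 4 < 4 := Nat.mod_lt _ (by norm_num)
  have h4' : k % 4 < 4 := Nat.mod_lt _ (by norm_num)
  simp only [← (periodic_pow (I_pow_pow_four _)).map_mod_nat m,
    ← (periodic_pow (neg_I_pow_pow_four _)).map_mod_nat k]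
  rw [← (periodic_neg_one_pow_choose le_rfl).map_mod_nat m,
    ← (periodic_neg_one_pow_choose le_rfl).map_mod_nat k,
    ← (periodic_neg_one_pow_choose (by norm_num : 2 ≤ 3)).map_mod_nat m,
    ← (periodic_neg_one_pow_choose (by norm_num : 2 ≤ 3)).map_mod_nat k,
    ← (periodic_neg_one_pow_choose (by norm_num : 1 ≤ 3)).map_mod_nat m,
    ← (periodic_neg_one_pow_choose (by norm_num : 1 ≤ 3)).map_mod_nat k]
  have hI2 := Complex.I_sq
  have hI3 := Complex.I_pow_three
  have hI4 := Complex.I_pow_four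
  interval_cases m % 4 <;> interval_cases k % 4 <;>
    simp [Fin.sum_univ_four, ← pow_mul, Nat.choose, neg_pow Complex.I] <;> ring_nf <;>
    simp [hI2, hI3, hI4] <;> norm_num

end Phases

/-! ### The hypergraph state and its marginals -/

section Hypergraph
variable {ι : Type} [Fintype ι]

/-- The Hamming weight. -/
def weight (s : ι → Fin 2) : ℕ := (Finset.univ.filter fun i => s i = 1).card

theorem prodKet_equatorVec (r : Fin 4) (s : ι → Fin 2) :
    prodKet (fun _ => equatorVec r) s =
      (((√2 : ℝ) : ℂ)⁻¹) ^ Fintype.card ι * (Complex.I ^ (r : ℕ)) ^ weight s := by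
  have h : ∀ b : Fin 2, equatorVec r b =
      ((√2 : ℝ) : ℂ)⁻¹ * if b = 1 then Complex.I ^ (r : ℕ) else 1 := by
    intro b; fin_cases b <;> simp [equatorVec]
  simp only [prodKet, h, Finset.prod_mul_distrib, Finset.prod_ite, Finset.prod_const,
    one_pow, mul_one, Finset.card_univ, weight]

theorem disjoint_edges {d d' : ℕ} (h : d ≠ d') : Disjoint (edges ι d) (edges ι d') :=
  Finset.pairwise_disjoint_powersetCard _ h

variable [DecidableEq ι]

theorem prod_cZPhase_edges (d : ℕ) (s : ι → Fin 2) :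
    ∏ e ∈ edges ι d, cZPhase e s = (-1) ^ (weight s).choose d := by
  have h : (edges ι d).filter (fun e => ∀ i ∈ e, s i = 1) =
      Finset.powersetCard d (Finset.univ.filter fun i => s i = 1) := by
    ext e
    simp [edges, Finset.mem_powersetCard, Finset.subset_iff, and_comm]
  simp only [cZPhase, Finset.prod_ite, Finset.prod_const, one_pow, mul_one]
  rw [h, Finset.card_powersetCard, weight]

theorem hypergraphKet_edges (d : ℕ) (s : ι → Fin 2) : hypergraphKet (edges ι d) s =
    (-1) ^ (weight s).choose d * (((√2 : ℝ) : ℂ)⁻¹) ^ Fintype.card ι := by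
  rw [hypergraphKet, prod_cZPhase_edges]

/-- The outer product of two equatorial states. -/
noncomputable def outer (x : Fin 4 × Fin 4) : Matrix (Fin 2) (Fin 2) ℂ :=
  vecMulVec (equatorVec x.1) (star (equatorVec x.2))

theorem outer_self (r : Fin 4) : outer (r, r) = stabProj (Sum.inl r) := by
  rw [← stabVec_outer]; rfl

theorem norm_outer_le (x : Fin 4 × Fin 4) (a b : Fin 2) : ‖outer x a b‖ ≤ 1 := by
  rw [outer, equatorVec_outer]
  fin_cases a <;> fin_cases b <;> simp <;> norm_num

/-- The projector onto the `3`-complete hypergraph state as a sum of product operators. -/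
theorem proj_hypergraphKet_edges_three : proj (hypergraphKet (edges ι 3)) =
    ∑ x : Fin 4 × Fin 4, (gammaCoeff x.1 * star (gammaCoeff x.2) / 4) •
      prodOp fun _ : ι => outer x := by
  have h : hypergraphKet (edges ι 3) =
      ∑ r, (gammaCoeff r / 2) • prodKet fun _ : ι => equatorVec r := by
    ext s
    simp only [hypergraphKet_edges, Finset.sum_apply, Pi.smul_apply, smul_eq_mul,
      prodKet_equatorVec, neg_one_pow_choose_three, Finset.mul_sum, Finset.sum_mul]
    exact Finset.sum_congr rfl fun r _ => by ring
  ext s t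
  rw [h, proj, vecMulVec_apply, Matrix.sum_apply, Fintype.sum_prod_type]
  simp only [Pi.star_apply, Finset.sum_apply, star_sum, Finset.sum_mul_sum, Pi.smul_apply,
    smul_eq_mul, star_mul', Matrix.smul_apply, prodOp, outer, vecMulVec_apply, prodKet,
    Finset.prod_mul_distrib, star_prod]
  refine Finset.sum_congr rfl fun r _ => Finset.sum_congr rfl fun r' _ => ?_
  simp
  ring

theorem fourMixture_eq :
    fourMixture ι = ∑ r : Fin 4, (1 / 4 : ℝ) • prodOp fun _ : ι => outer (r, r) := by
  have d32 := disjoint_edges (ι := ι) (by norm_num : 3 ≠ 2)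
  have d31 := disjoint_edges (ι := ι) (by norm_num : 3 ≠ 1)
  have d321 : Disjoint (edges ι 3 ∪ edges ι 2) (edges ι 1) :=
    Finset.disjoint_union_left.2 ⟨d31, disjoint_edges (by norm_num)⟩
  ext s t
  rw [fourMixture, ← Finset.smul_sum]
  simp only [Matrix.smul_apply]
  congr 1
  have h1 : ∀ r : Fin 4, prodOp (fun _ : ι => outer (r, r)) s t =
      ((((√2 : ℝ) : ℂ)⁻¹) ^ Fintype.card ι) ^ 2 *
        ((Complex.I ^ (r : ℕ)) ^ weight s * ((-Complex.I) ^ (r : ℕ)) ^ weight t) := fun r => by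
    have : prodOp (fun _ : ι => outer (r, r)) = proj (prodKet fun _ => equatorVec r) := by
      rw [proj_prodKet]; rfl
    rw [this, proj, vecMulVec_apply, Pi.star_apply, prodKet_equatorVec, prodKet_equatorVec]
    simp
    ring
  simp only [Matrix.sum_apply, h1, ← Finset.mul_sum, sum_I_pow_eq]
  simp only [Matrix.add_apply, proj, vecMulVec_apply, Pi.star_apply, hypergraphKet,
    Finset.prod_union d321, Finset.prod_union d32, Finset.prod_union d31, prod_cZPhase_edges]
  simp
  ring

theorem fourMixture_mem_STAB : fourMixture ι ∈ STAB ι := by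
  rw [fourMixture_eq]
  refine (convex_convexHull ℝ _).sum_mem (fun _ _ => by norm_num) (by norm_num) fun r _ => ?_
  simp only [outer_self]
  exact prodOp_stabProj_mem_STAB fun _ => Sum.inl r

theorem norm_gammaCoeff (r : Fin 4) : ‖gammaCoeff r‖ = 1 := by
  fin_cases r <;> simp [gammaCoeff]

theorem gammaCoeff_mul_star (r : Fin 4) : gammaCoeff r * star (gammaCoeff r) = 1 := by
  rw [Complex.star_def, Complex.mul_conj, Complex.normSq_eq_norm_sq, norm_gammaCoeff]
  norm_num

theorem trace_outer (x : Fin 4 × Fin 4) :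
    (outer x).trace = (1 + Complex.I ^ (x.1 : ℕ) * (-Complex.I) ^ (x.2 : ℕ)) / 2 := by
  rw [outer, equatorVec_outer, Matrix.trace_fin_two]
  simp
  ring

theorem trace_outer_self (r : Fin 4) : (outer (r, r)).trace = 1 := by
  rw [outer_self, trace_stabProj]

/-- The value is `|1 + i^(r - r')| / 2`, which is 0 or 1/√2; 3/4 is a rational upper bound. -/
theorem norm_trace_outer_le {x : Fin 4 × Fin 4} (hx : x.1 ≠ x.2) :
    ‖(outer x).trace‖ ≤ 3 / 4 := by
  rw [trace_outer]
  obtain ⟨r, r'⟩ := x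
  rw [← abs_of_nonneg (norm_nonneg _), ← abs_of_nonneg (by norm_num : (0 : ℝ) ≤ 3 / 4), ← sq_le_sq,
    ← Complex.normSq_eq_norm_sq]
  fin_cases r <;> fin_cases r' <;> simp [Complex.normSq_apply, pow_succ] at hx ⊢ <;> norm_num

/-- Diagonal terms cancel exactly. The factor 4 is a crude count of all sixteen terms, each at most
a quarter of the decaying power. -/
theorem norm_reduced_sub_fourMixture_le (J : Finset ι) (a b : J → Fin 2) :
    ‖reduced J (proj (hypergraphKet (edges ι 3))) a b - fourMixture J a b‖ ≤
      4 * (3 / 4) ^ (Fintype.card ι - J.card) := by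
  have h4 : fourMixture J = ∑ x : Fin 4 × Fin 4, (if x.1 = x.2 then (1 / 4 : ℂ) else 0) •
      prodOp fun _ : J => outer x := by
    rw [fourMixture_eq, Fintype.sum_prod_type]
    refine Finset.sum_congr rfl fun r _ => ?_
    simp only [ite_smul, zero_smul, Finset.sum_ite_eq, Finset.mem_univ, if_true]
    rw [← Complex.coe_smul]
    norm_num
  rw [proj_hypergraphKet_edges_three, reduced_sum, h4, ← Matrix.sub_apply,
    ← Finset.sum_sub_distrib, Matrix.sum_apply]
  refine (norm_sum_le _ _).trans ?_
  have key : ∀ x : Fin 4 × Fin 4, ‖((gammaCoeff x.1 * star (gammaCoeff x.2) / 4) •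
      reduced J (prodOp fun _ : ι => outer x) -
      (if x.1 = x.2 then (1 / 4 : ℂ) else 0) • prodOp fun _ : J => outer x) a b‖ ≤
      1 / 4 * (3 / 4) ^ (Fintype.card ι - J.card) := by
    intro x
    rw [reduced_prodOp, smul_smul, ← sub_smul, Matrix.smul_apply, norm_smul]
    have h1 : ‖prodOp (fun _ : J => outer x) a b‖ ≤ 1 := by
      rw [prodOp, norm_prod]
      exact Finset.prod_le_one (fun _ _ => norm_nonneg _) fun _ _ => norm_outer_le _ _ _
    refine (mul_le_of_le_one_right (norm_nonneg _) h1).trans ?_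
    split_ifs with h
    · obtain ⟨r, r'⟩ := x
      obtain rfl : r = r' := h
      simp only [gammaCoeff_mul_star, trace_outer_self, Finset.prod_const_one, mul_one, sub_self,
        norm_zero]
      positivity
    · simp only [sub_zero, norm_mul, norm_div, norm_star, norm_gammaCoeff, Finset.prod_const,
        Finset.card_univ, Fintype.card_coe, Finset.card_compl, norm_pow]
      have := pow_le_pow_left₀ (norm_nonneg _) (norm_trace_outer_le h) (Fintype.card ι - J.card)
      norm_num at this ⊢
      exact this
  refine (Finset.sum_le_sum fun x _ => key x).trans ?_
  simp
  linarith

theorem norm_hypergraphKet_sq (s : ι → Fin 2) :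
    ‖hypergraphKet (edges ι 3) s‖ ^ 2 = (1 / 2) ^ Fintype.card ι := by
  rw [hypergraphKet_edges, norm_mul, norm_pow, norm_pow, norm_neg, norm_one, one_pow, one_mul,
    ← pow_mul, mul_comm, pow_mul, norm_inv, inv_pow, Complex.norm_real, Real.norm_eq_abs, sq_abs,
    Real.sq_sqrt (by norm_num)]
  norm_num

theorem trace_reduced (J : Finset ι) : (reduced J (proj (hypergraphKet (edges ι 3)))).trace = 1 := by
  have h : ∀ s : ι → Fin 2, proj (hypergraphKet (edges ι 3)) s s = (1 / 2) ^ Fintype.card ι := by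
    intro s
    rw [proj, vecMulVec_apply, Pi.star_apply, Complex.star_def, Complex.mul_conj,
      Complex.normSq_eq_norm_sq, norm_hypergraphKet_sq]
    norm_num
  simp only [Matrix.trace, Matrix.diag, reduced, h, Finset.sum_const, Finset.card_univ,
    Fintype.card_fun, Fintype.card_fin, Fintype.card_coe, Finset.card_compl, nsmul_eq_mul]
  have hJ : J.card ≤ Fintype.card ι := Finset.card_le_univ J
  push_cast
  rw [← mul_assoc, ← pow_add, Nat.add_sub_cancel' hJ, ← mul_pow]
  norm_num

theorem exists_mem_robustnessSet_reduced (J : Finset ι) :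
    ∃ r ∈ robustnessSet (reduced J (proj (hypergraphKet (edges ι 3)))),
      r ≤ 1 + 8 * 24 ^ J.card * (3 / 4) ^ (Fintype.card ι - J.card) := by
  obtain ⟨h1, h2⟩ := isHermitian_of_mem_STAB (fourMixture_mem_STAB (ι := J))
  obtain ⟨r, hr, hle⟩ := mem_robustnessSet_of_close
    (by rw [reduced_conjTranspose, proj_conjTranspose]) h1
    fourMixture_mem_STAB ((trace_reduced J).trans h2.symm) (norm_reduced_sub_fourMixture_le J)
  refine ⟨r, hr, hle.trans (le_of_eq ?_)⟩
  rw [Fintype.card_coe]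
  ring

end Hypergraph

/-! ### Vanishing local magic -/

theorem tendsto_three_quarters_pow_sub (C : ℝ) (K : ℕ) :
    Tendsto (fun n => C * (3 / 4 : ℝ) ^ (n - K)) atTop (𝓝 0) := by
  have h := (tendsto_pow_atTop_nhds_zero_of_lt_one (by norm_num : (0 : ℝ) ≤ 3 / 4)
    (by norm_num)).comp (tendsto_sub_atTop_nat K)
  simpa using h.const_mul C

theorem tendsto_reduced_gamma (K : ℕ) (δ : ℝ) (hδ : 0 < δ) :
    ∀ᶠ n in atTop, ∀ J : Finset (Fin n), J.card = K → ∀ a b,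
      ‖reduced J (proj (gammaKet n)) a b - fourMixture J a b‖ < δ := by
  filter_upwards [(tendsto_three_quarters_pow_sub 4 K).eventually (gt_mem_nhds hδ)]
    with n hn J hJ a b
  refine (norm_reduced_sub_fourMixture_le J a b).trans_lt ?_
  rwa [hJ, Fintype.card_fin]

theorem vanishingLocalMagic_gamma : VanishingLocalMagic fun n => proj (gammaKet n) := by
  intro K
  have hlim : Tendsto (fun n => 1 + 8 * 24 ^ K * (3 / 4 : ℝ) ^ (n - K)) atTop (𝓝 1) := by
    simpa using (tendsto_three_quarters_pow_sub (8 * 24 ^ K) K).const_add 1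
  have hJ : ∀ n (J : {J : Finset (Fin n) // J.card = K}),
      1 ≤ RoM (reduced J.1 (proj (gammaKet n))) ∧
      RoM (reduced J.1 (proj (gammaKet n))) ≤ 1 + 8 * 24 ^ K * (3 / 4 : ℝ) ^ (n - K) := by
    intro n J
    obtain ⟨r, hr, hle⟩ := exists_mem_robustnessSet_reduced J.1
    rw [J.2, Fintype.card_fin] at hle
    exact ⟨one_le_RoM ⟨r, hr⟩, (RoM_le_of_mem hr).trans hle⟩
  -- For `n < K` the supremum runs over an empty type and is 0, so the bounds hold only eventually.
  have hne : ∀ n, K ≤ n → Nonempty {J : Finset (Fin n) // J.card = K} := fun n hn => by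
    obtain ⟨J, -, hJ⟩ := Finset.exists_subset_card_eq (s := (Finset.univ : Finset (Fin n)))
      (by simpa using hn)
    exact ⟨⟨J, hJ⟩⟩
  refine tendsto_of_tendsto_of_tendsto_of_le_of_le' tendsto_const_nhds hlim ?_ ?_
  · filter_upwards [eventually_ge_atTop K] with n hn
    obtain ⟨J⟩ := hne n hn
    exact (hJ n J).1.trans (le_ciSup (f := fun J : {J : Finset (Fin n) // J.card = K} =>
      RoM (reduced J.1 (proj (gammaKet n)))) (Set.finite_range _).bddAbove J)
  · filter_upwards [eventually_ge_atTop K] with n hn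
    have := hne n hn
    exact ciSup_le fun J => (hJ n J).2

/-! ### Local noise on the hypergraph state -/

section Noise
variable {ι : Type} [Fintype ι] [DecidableEq ι]

theorem depolarize_gamma (r : ℝ) : depolarize r (proj (hypergraphKet (edges ι 3))) =
    ∑ x : Fin 4 × Fin 4, (gammaCoeff x.1 * star (gammaCoeff x.2) / 4) •
      prodOp fun _ : ι => depolarize₁ r (outer x) := by
  simp only [proj_hypergraphKet_edges_three, depolarize_sum, depolarize_prodOp]

theorem trace_depolarize₁ (r : ℝ) (A : Matrix (Fin 2) (Fin 2) ℂ) :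
    (depolarize₁ r A).trace = A.trace := by
  simp [depolarize₁, Matrix.trace_add, Matrix.trace_smul]
  ring

theorem trace_depolarize_gamma (r : ℝ) :
    (depolarize r (proj (hypergraphKet (edges ι 3)))).trace = 1 := by
  have h : (proj (hypergraphKet (edges ι 3))).trace = 1 := by
    refine trace_proj ?_
    simp only [norm_hypergraphKet_sq, Finset.sum_const, Finset.card_univ, Fintype.card_fun,
      Fintype.card_fin, nsmul_eq_mul]
    push_cast
    rw [← mul_pow]
    norm_num
  rw [← h, depolarize_gamma, proj_hypergraphKet_edges_three]
  simp only [Matrix.trace_sum, Matrix.trace_smul, trace_prodOp, trace_depolarize₁]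

theorem depolarize_gamma_conjTranspose (r : ℝ) :
    (depolarize r (proj (hypergraphKet (edges ι 3))))ᴴ =
      depolarize r (proj (hypergraphKet (edges ι 3))) := by
  rw [depolarize_conjTranspose, proj_conjTranspose]

/-! ### Lower bound: exponential growth of the aligned Pauli sum -/

/-- Phases that align the Pauli spectrum of `outer (0, 1)`. -/
noncomputable def alignPhase : Fin 4 → ℂ := ![1, 1, 1, -Complex.I]

theorem norm_alignPhase (q : Fin 4) : ‖alignPhase q‖ = 1 := by
  fin_cases q <;> simp [alignPhase]

/-- The sum of the aligned Pauli spectrum. -/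
noncomputable def alignedSum (A : Matrix (Fin 2) (Fin 2) ℂ) : ℂ :=
  ∑ q, alignPhase q * (pauli q * A).trace

/-- The maximally mixed part is seen only by the identity Pauli, whose phase is 1. -/
theorem alignedSum_depolarize₁ (r : ℝ) (A : Matrix (Fin 2) (Fin 2) ℂ) :
    alignedSum (depolarize₁ r A) = r * A.trace + (1 - r) * alignedSum A := by
  simp [alignedSum, alignPhase, Fin.sum_univ_four, depolarize₁, Matrix.trace_fin_two, pauli,
    Matrix.mul_apply, Fin.sum_univ_two]
  ring

/-- After alignment all four Pauli coefficients equal `(1 - i)/2`, so the modulus is 2√2, above the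
stabilizer value 2. -/
theorem alignedSum_outer_zero_one : alignedSum (outer (0, 1)) = 2 * (1 - Complex.I) := by
  rw [outer, equatorVec_outer]
  simp [alignedSum, alignPhase, Fin.sum_univ_four, Matrix.trace_fin_two, pauli,
    Matrix.mul_apply, Fin.sum_univ_two]
  ring_nf
  simp
  ring

theorem norm_alignedSum_outer_le {x : Fin 4 × Fin 4} (hx : x ≠ (0, 1)) :
    ‖alignedSum (outer x)‖ ≤ 2 := by
  rw [outer, equatorVec_outer, ← abs_of_nonneg (norm_nonneg _),
    ← abs_of_nonneg (by norm_num : (0 : ℝ) ≤ 2), ← sq_le_sq, ← Complex.normSq_eq_norm_sq]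
  obtain ⟨r, r'⟩ := x
  fin_cases r <;> fin_cases r' <;>
    simp [alignedSum, alignPhase, Fin.sum_univ_four, Matrix.trace_fin_two, pauli,
      Matrix.mul_apply, Fin.sum_univ_two, Complex.normSq_apply, pow_succ] at hx ⊢ <;> norm_num

theorem norm_trace_outer_le_one (x : Fin 4 × Fin 4) : ‖(outer x).trace‖ ≤ 1 := by
  rw [trace_outer, norm_div, Complex.norm_ofNat, div_le_one (by norm_num)]
  refine (norm_add_le _ _).trans ?_
  simp
  norm_num

theorem sum_alignPhase_mul_trace (r : ℝ) :
    ∑ p : ι → Fin 4, (∏ i, alignPhase (p i)) *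
        (pauliString p * depolarize r (proj (hypergraphKet (edges ι 3)))).trace =
      ∑ x : Fin 4 × Fin 4, gammaCoeff x.1 * star (gammaCoeff x.2) / 4 *
        alignedSum (depolarize₁ r (outer x)) ^ Fintype.card ι := by
  simp only [depolarize_gamma, Finset.mul_sum, Matrix.trace_sum, Matrix.mul_smul,
    Matrix.trace_smul, pauliString_eq_prodOp, prodOp_mul, trace_prodOp, smul_eq_mul]
  rw [Finset.sum_comm]
  refine Finset.sum_congr rfl fun x _ => ?_
  have h := sum_pi_prod fun (_ : ι) q =>
    alignPhase q * (pauli q * depolarize₁ r (outer x)).trace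
  rw [Finset.prod_const, Finset.card_univ] at h
  rw [alignedSum, ← h, Finset.mul_sum]
  refine Finset.sum_congr rfl fun p _ => ?_
  rw [Finset.prod_mul_distrib]
  ring

theorem norm_sum_alignPhase_le (ρ : Op ι) :
    ‖∑ p : ι → Fin 4, (∏ i, alignPhase (p i)) * (pauliString p * ρ).trace‖ ≤ pauliNorm ρ := by
  refine (norm_sum_le _ _).trans (le_of_eq ?_)
  simp [pauliNorm, norm_prod, norm_alignPhase]

theorem norm_one_sub_I : ‖1 - Complex.I‖ = √2 := by
  rw [← Real.sqrt_sq (norm_nonneg _), ← Complex.normSq_eq_norm_sq]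
  simp [Complex.normSq_apply]
  norm_num

theorem pauliNorm_depolarize_gamma_ge {r : ℝ} (h0 : 0 ≤ r) (h1 : r ≤ 39 / 100) :
    1 / 4 * (2 * (2001 / 2000 : ℝ)) ^ Fintype.card ι - 4 * 2 ^ Fintype.card ι ≤
      pauliNorm (depolarize r (proj (hypergraphKet (edges ι 3)))) := by
  refine le_trans ?_ (norm_sum_alignPhase_le _)
  rw [sum_alignPhase_mul_trace, ← Finset.add_sum_erase _ _ (Finset.mem_univ ((0, 1) : Fin 4 × Fin 4))]
  refine le_trans ?_ (norm_sub_le_norm_add _ _)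
  refine sub_le_sub ?_ ?_
  · rw [norm_mul, norm_pow, norm_div, norm_mul, norm_star, norm_gammaCoeff, norm_gammaCoeff]
    rw [mul_one, Complex.norm_ofNat]
    refine mul_le_mul_of_nonneg_left (pow_le_pow_left₀
      (by norm_num : (0 : ℝ) ≤ 2 * (2001 / 2000)) ?_ _) (by norm_num : (0 : ℝ) ≤ 1 / 4)
    have h : alignedSum (depolarize₁ r (outer (0, 1))) =
        (((4 - 3 * r) / 2 : ℝ) : ℂ) * (1 - Complex.I) := by
      rw [alignedSum_depolarize₁, alignedSum_outer_zero_one, trace_outer]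
      simp
      ring
    rw [h, norm_mul, norm_one_sub_I, Complex.norm_real, Real.norm_of_nonneg (by linarith)]
    -- The base `(4 - 3r)/2 * √2` exceeds 2 exactly for `r < (4 - 2√2)/3 ≈ 0.3905`; at 0.39 it is
    -- just above 2.001, whence 2001/2000.
    have h2 : (1.41421 : ℝ) ≤ √2 := Real.le_sqrt_of_sq_le (by norm_num)
    nlinarith
  · have hx : ∀ x ∈ Finset.univ.erase ((0, 1) : Fin 4 × Fin 4),
        ‖gammaCoeff x.1 * star (gammaCoeff x.2) / 4 *
          alignedSum (depolarize₁ r (outer x)) ^ Fintype.card ι‖ ≤ 1 / 4 * 2 ^ Fintype.card ι := by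
      intro x hx
      rw [norm_mul, norm_pow, norm_div, norm_mul, norm_star, norm_gammaCoeff, norm_gammaCoeff]
      rw [mul_one, Complex.norm_ofNat]
      refine mul_le_mul_of_nonneg_left (pow_le_pow_left₀ (norm_nonneg _) ?_ _) (by norm_num : (0 : ℝ) ≤ 1 / 4)
      rw [alignedSum_depolarize₁]
      refine (norm_add_le _ _).trans ?_
      rw [norm_mul, norm_mul, ← Complex.ofReal_one, ← Complex.ofReal_sub, Complex.norm_real,
        Complex.norm_real, Real.norm_of_nonneg h0, Real.norm_of_nonneg (by linarith)]
      have h2 := norm_alignedSum_outer_le (Finset.ne_of_mem_erase hx)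
      have h3 := norm_trace_outer_le_one x
      nlinarith
    refine (norm_sum_le _ _).trans ((Finset.sum_le_sum hx).trans ?_)
    rw [Finset.sum_const, Finset.card_erase_of_mem (Finset.mem_univ _)]
    simp
    have : (0 : ℝ) < 2 ^ Fintype.card ι := by positivity
    linarith

theorem RoM_depolarize_gamma_ge {r : ℝ} (h0 : 0 ≤ r) (h1 : r ≤ 39 / 100) :
    1 / 4 * (2001 / 2000 : ℝ) ^ Fintype.card ι - 4 ≤
      RoM (depolarize r (proj (hypergraphKet (edges ι 3)))) := by
  have h := (pauliNorm_depolarize_gamma_ge (ι := ι) h0 h1).trans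
    (pauliNorm_le_RoM (robustnessSet_nonempty (depolarize_gamma_conjTranspose r)
      (trace_depolarize_gamma r)))
  rw [mul_pow] at h
  refine le_of_mul_le_mul_left ?_ (by positivity : (0 : ℝ) < 2 ^ Fintype.card ι)
  linarith

/-! ### Upper bound: stabilizer decomposition at noise 39/50 -/

/-- Weights of the stabilizer projectors in the noisy equatorial state `outer (r, r)`. -/
noncomputable def diagWeight (r : Fin 4) : Fin 4 ⊕ Fin 2 → ℝ :=
  Sum.elim (fun k => ![11 / 50, 3 / 25, 0, 3 / 25] (k - r)) fun _ => 27 / 100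

/-- Coefficients of the stabilizer projectors in the noisy operator `outer x`. -/
noncomputable def noisyCoeff (x : Fin 4 × Fin 4) : Fin 4 ⊕ Fin 2 → ℂ :=
  Sum.elim
    (fun k => ![![11 / 50, 3 / 25, 0, 3 / 25],
      ![(1 - Complex.I) * (11 / 100), (1 - Complex.I) * (2 / 25), 0, (1 - Complex.I) * (-3 / 100)],
      ![0, -11 / 100 * Complex.I, 0, 11 / 100 * Complex.I],
      ![(1 + Complex.I) * (11 / 100), (1 + Complex.I) * (-3 / 100), 0,
        (1 + Complex.I) * (2 / 25)]] (x.2 - x.1) (k - x.1))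
    fun b => ![![27 / 100, 27 / 100],
      ![(1 - Complex.I) * (17 / 100 + 11 / 200 * Complex.I),
        (1 - Complex.I) * (17 / 100 - 11 / 200 * Complex.I)],
      ![11 / 100, -11 / 100],
      ![(1 + Complex.I) * (17 / 100 - 11 / 200 * Complex.I),
        (1 + Complex.I) * (17 / 100 + 11 / 200 * Complex.I)]] (x.2 - x.1) b

theorem noisyCoeff_self (r : Fin 4) (w : Fin 4 ⊕ Fin 2) :
    noisyCoeff (r, r) w = (diagWeight r w : ℝ) := by
  rcases w with k | b
  · simp only [noisyCoeff, diagWeight, Sum.elim_inl, sub_self]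
    generalize k - r = j
    fin_cases j <;> simp
  · fin_cases b <;> simp [noisyCoeff, diagWeight]

theorem diagWeight_nonneg (r : Fin 4) (w : Fin 4 ⊕ Fin 2) : 0 ≤ diagWeight r w := by
  rcases w with k | b
  · simp only [diagWeight, Sum.elim_inl]
    generalize k - r = j
    fin_cases j <;> simp <;> norm_num
  · simp only [diagWeight, Sum.elim_inr]
    norm_num

/-- The weights are chosen for this domination. It forces both sides to vanish at the projector
antipodal to `x.1`; the tightest ratio is `√2 * (2/25) / (3/25) ≈ 0.943`. -/
theorem norm_noisyCoeff_le {x : Fin 4 × Fin 4} (hx : x.1 ≠ x.2) (w : Fin 4 ⊕ Fin 2) :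
    ‖noisyCoeff x w‖ ≤ 19 / 20 * diagWeight x.1 w := by
  have hm : x.2 - x.1 ≠ 0 := sub_ne_zero.2 hx.symm
  rw [← abs_of_nonneg (norm_nonneg _),
    ← abs_of_nonneg (mul_nonneg (by norm_num) (diagWeight_nonneg x.1 w) :
      (0 : ℝ) ≤ 19 / 20 * diagWeight x.1 w),
    ← sq_le_sq, ← Complex.normSq_eq_norm_sq]
  rcases w with k | b
  · simp only [noisyCoeff, diagWeight, Sum.elim_inl]
    generalize x.2 - x.1 = m at hm
    generalize k - x.1 = j
    fin_cases m <;> fin_cases j <;> simp [Complex.normSq_apply] at hm ⊢ <;> norm_num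
  · simp only [noisyCoeff, diagWeight, Sum.elim_inr]
    generalize x.2 - x.1 = m at hm
    fin_cases m <;> fin_cases b <;> simp [Complex.normSq_apply] at hm ⊢ <;> norm_num

theorem sum_smul_stabProj (c : Fin 4 ⊕ Fin 2 → ℂ) : ∑ w, c w • stabProj w =
    !![(c (.inl 0) + c (.inl 1) + c (.inl 2) + c (.inl 3)) / 2 + c (.inr 0),
      (c (.inl 0) - c (.inl 2) - Complex.I * (c (.inl 1) - c (.inl 3))) / 2;
      (c (.inl 0) - c (.inl 2) + Complex.I * (c (.inl 1) - c (.inl 3))) / 2,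
      (c (.inl 0) + c (.inl 1) + c (.inl 2) + c (.inl 3)) / 2 + c (.inr 1)] := by
  have h3 := Complex.I_pow_three
  ext a b
  fin_cases a <;> fin_cases b <;>
    simp [stabProj, Fintype.sum_sum_type, Fin.sum_univ_four, Matrix.sum_apply, neg_pow Complex.I,
      h3] <;> ring

theorem depolarize₁_of (a b c d : ℂ) : depolarize₁ (39 / 50) !![a, b; c, d] =
    !![11 / 50 * a + 39 / 100 * (a + d), 11 / 50 * b;
      11 / 50 * c, 11 / 50 * d + 39 / 100 * (a + d)] := by
  ext i j
  fin_cases i <;> fin_cases j <;> simp [depolarize₁, Matrix.trace_fin_two] <;> ring_nf <;>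
    simp

theorem depolarize₁_outer (x : Fin 4 × Fin 4) :
    depolarize₁ (39 / 50) (outer x) = ∑ w, noisyCoeff x w • stabProj w := by
  obtain ⟨r, r'⟩ := x
  have hI2 := Complex.I_sq
  have hI3 := Complex.I_pow_three
  rw [outer, equatorVec_outer, depolarize₁_of, sum_smul_stabProj]
  congr 1
  fin_cases r <;> fin_cases r' <;>
    simp [noisyCoeff, neg_pow Complex.I, hI3] <;> ring_nf <;> simp [hI2] <;> ring_nf <;>
    simp

theorem depolarize_gamma_mem_STAB (hn : 3 * (19 / 20 : ℝ) ^ Fintype.card ι ≤ 1) :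
    depolarize (39 / 50) (proj (hypergraphKet (edges ι 3))) ∈ STAB ι := by
  refine mem_STAB_of_nonneg (eq_sum_re_of_isHermitian (depolarize_gamma_conjTranspose _)
    (z := fun w => ∑ x : Fin 4 × Fin 4, gammaCoeff x.1 * star (gammaCoeff x.2) / 4 *
      ∏ i, noisyCoeff x (w i)) ?_) (fun w => ?_) (trace_depolarize_gamma _)
  · simp only [depolarize_gamma, depolarize₁_outer, prodOp_sum, Finset.smul_sum, smul_smul,
      Finset.sum_smul]
    exact Finset.sum_comm
  · rw [Complex.re_sum]
    -- Each off-diagonal term is charged to the diagonal weight of its row `x.1`; a row has one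
    -- diagonal and three off-diagonal terms, hence the hypothesis `3 * (19/20) ^ n ≤ 1`.
    have hx : ∀ x : Fin 4 × Fin 4, (if x.1 = x.2 then 1 / 4 * ∏ i, diagWeight x.1 (w i)
        else -(1 / 4 * ((19 / 20) ^ Fintype.card ι * ∏ i, diagWeight x.1 (w i)))) ≤
        (gammaCoeff x.1 * star (gammaCoeff x.2) / 4 * ∏ i, noisyCoeff x (w i)).re := by
      intro x
      split_ifs with h
      · obtain ⟨r, r'⟩ := x
        obtain rfl : r = r' := h
        simp only [noisyCoeff_self, gammaCoeff_mul_star]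
        rw [← Complex.ofReal_prod, Complex.re_mul_ofReal]
        norm_num
      · refine neg_le_of_abs_le ((Complex.abs_re_le_norm _).trans ?_)
        rw [norm_mul, norm_div, norm_mul, norm_star, norm_gammaCoeff, norm_gammaCoeff, norm_prod]
        rw [mul_one, Complex.norm_ofNat]
        refine mul_le_mul_of_nonneg_left ?_ (by norm_num : (0 : ℝ) ≤ 1 / 4)
        refine (Finset.prod_le_prod (fun _ _ => norm_nonneg _)
          fun i _ => norm_noisyCoeff_le h (w i)).trans (le_of_eq ?_)
        rw [Finset.prod_mul_distrib, Finset.prod_const, Finset.card_univ]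
    refine le_trans ?_ (Finset.sum_le_sum fun x _ => hx x)
    rw [Fintype.sum_prod_type]
    refine Finset.sum_nonneg fun r _ => ?_
    have hP : 0 ≤ ∏ i, diagWeight r (w i) := Finset.prod_nonneg fun i _ => diagWeight_nonneg _ _
    set P := ∏ i, diagWeight r (w i)
    have h3 : ∑ r' : Fin 4, (if r = r' then 1 / 4 * P
        else -(1 / 4 * ((19 / 20) ^ Fintype.card ι * P))) =
        1 / 4 * P * (1 - 3 * (19 / 20) ^ Fintype.card ι) := by
      fin_cases r <;> simp [Fin.sum_univ_four] <;> ring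
    rw [h3]
    exact mul_nonneg (by positivity) (by linarith)

end Noise

/-! ### The magic noise threshold -/

theorem magicThreshold_gamma (ε : ℝ) (hε : 0 ≤ ε) : ∀ᶠ n in atTop,
    0.39 ≤ magicThreshold ε (proj (gammaKet n)) ∧
    magicThreshold ε (proj (gammaKet n)) ≤ 0.78 := by
  -- Arranged so that the lower bound `1/4 * (2001/2000) ^ n - 4` exceeds `1 + ε`.
  have h1 : ∀ᶠ n : ℕ in atTop, 4 * (1 + ε + 4) < (2001 / 2000 : ℝ) ^ n :=
    (tendsto_pow_atTop_atTop_of_one_lt (by norm_num)).eventually_gt_atTop _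
  have h2 : ∀ᶠ n : ℕ in atTop, 3 * (19 / 20 : ℝ) ^ n < 1 := by
    have := (tendsto_pow_atTop_nhds_zero_of_lt_one (by norm_num : (0 : ℝ) ≤ 19 / 20)
      (by norm_num)).const_mul 3
    rw [mul_zero] at this
    exact this.eventually (gt_mem_nhds one_pos)
  filter_upwards [h1, h2] with n h1 h2
  have hmem : (39 / 50 : ℝ) ∈
      {r | 0 ≤ r ∧ r ≤ 1 ∧ RoM (depolarize r (proj (gammaKet n))) ≤ 1 + ε} := by
    refine ⟨by norm_num, by norm_num, ?_⟩
    have := RoM_le_one_of_mem_STAB (depolarize_gamma_mem_STAB (ι := Fin n)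
      (by rw [Fintype.card_fin]; exact h2.le))
    exact this.trans (by linarith)
  constructor
  · refine le_csInf ⟨_, hmem⟩ fun r ⟨hr0, _, hr⟩ => ?_
    by_contra hlt
    have := (RoM_depolarize_gamma_ge (ι := Fin n) hr0 (by norm_num at hlt; linarith)).trans hr
    rw [Fintype.card_fin] at this
    linarith
  · refine (csInf_le ⟨0, fun r hr => hr.1⟩ hmem).trans (by norm_num)

theorem nonvanishingMagicThreshold_gamma (ε : ℝ) (hε : 0 ≤ ε) :
    NonvanishingMagicThreshold ε fun n => proj (gammaKet n) := by
  have h := magicThreshold_gamma ε hε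
  refine lt_of_lt_of_le (by norm_num : (0 : ℝ) < 0.39)
    (le_liminf_of_le ?_ (h.mono fun _ hn => hn.1))
  -- A real `liminf` needs coboundedness, supplied by the upper bound 0.78.
  exact IsCoboundedUnder.of_frequently_le (h.mono fun _ hn => hn.2).frequently

/-! ### Circuit preparing the hypergraph state -/

section Circuit
variable {ι : Type} [Fintype ι] [DecidableEq ι]

/-- The effect of a list of gates on a vector. -/
noncomputable def applyGates (C : List (Gate ι)) (ψ : Ket ι) : Ket ι :=
  C.foldl (fun ψ g => g.toOp *ᵥ ψ) ψ

theorem onQubit_mulVec (i : ι) (A : Matrix (Fin 2) (Fin 2) ℂ) (ψ : Ket ι) (s : ι → Fin 2) :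
    (onQubit i A *ᵥ ψ) s = ∑ b, A (s i) b * ψ (Function.update s i b) := by
  have h : (onQubit i A *ᵥ ψ) s =
      ∑ t ∈ Finset.univ.image (Function.update s i), A (s i) (t i) * ψ t := by
    simp only [Matrix.mulVec, dotProduct, onQubit, ite_mul, zero_mul]
    rw [← Finset.sum_filter]
    refine Finset.sum_congr ?_ fun _ _ => rfl
    ext t
    simp only [Finset.mem_filter, Finset.mem_univ, true_and, Finset.mem_image]
    constructor
    · intro ht
      refine ⟨t i, funext fun j => ?_⟩
      by_cases hj : j = i
      · subst hj; simp
      · simp [hj, ht j hj]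
    · rintro ⟨b, rfl⟩ j hj
      simp [hj]
  rw [h, Finset.sum_image fun a _ b _ hab => Function.update_injective s i hab]
  simp

theorem applyGates_hadamard {l : List ι} (hl : l.Nodup) (s : ι → Fin 2) :
    applyGates (l.map Gate.hadamard) (zeroKet ι) s =
      if ∀ i, i ∉ l → s i = 0 then (((√2 : ℝ) : ℂ)⁻¹) ^ l.length else 0 := by
  induction l using List.reverseRecOn generalizing s with
  | nil =>
    simp [applyGates, zeroKet, Pi.single_apply, funext_iff]
  | append_singleton l i ih =>
    obtain ⟨hl, -, hi⟩ := List.nodup_append.1 hl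
    have hi : i ∉ l := fun h => hi i h i (by simp) rfl
    have hstep : applyGates ((l ++ [i]).map Gate.hadamard) (zeroKet ι) =
        (Gate.hadamard i).toOp *ᵥ applyGates (l.map Gate.hadamard) (zeroKet ι) := by
      simp [applyGates]
    -- Qubit `i` has not been touched and is still 0, so only the first column of the Hadamard
    -- matrix contributes and its sign never appears.
    have h1 : ¬ ∀ j, j ∉ l → Function.update s i 1 j = 0 := fun h => by simpa using h i hi
    have h0 : (∀ j, j ∉ l → Function.update s i 0 j = 0) ↔ ∀ j, j ∉ l ++ [i] → s j = 0 := by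
      refine forall_congr' fun j => ?_
      by_cases hj : j = i
      · subst hj; simp
      · simp [hj]
    rw [hstep, Gate.toOp, onQubit_mulVec, Fin.sum_univ_two, ih hl, ih hl, if_neg h1]
    simp only [h0, mul_zero, add_zero, mul_ite, List.length_append, List.length_singleton, pow_succ']
    congr 1
    have : ∀ a : Fin 2, (!![(1 : ℂ), 1; 1, -1] : Matrix (Fin 2) (Fin 2) ℂ) a 0 = 1 := by
      intro a; fin_cases a <;> rfl
    simp [this]

/-- Comparing matrices instead of gates avoids the cardinality proofs carried by `Gate.cZ`. -/
theorem applyGates_cZ {E : List (Finset ι)} {C : List (Gate ι)}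
    (h : C.map Gate.toOp = E.map cZ) (ψ : Ket ι) (s : ι → Fin 2) :
    applyGates C ψ s = (E.map fun e => cZPhase e s).prod * ψ s := by
  induction C generalizing E ψ with
  | nil =>
    obtain rfl : E = [] := by simpa using h.symm
    simp [applyGates]
  | cons g C ih =>
    cases E with
    | nil => simp at h
    | cons e E =>
      simp only [List.map_cons, List.cons.injEq] at h
      have : applyGates (g :: C) ψ = applyGates C (g.toOp *ᵥ ψ) := rfl
      rw [this, ih h.2, h.1, cZ, Matrix.mulVec_diagonal, List.map_cons, List.prod_cons]
      ring

end Circuit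

/-- The `CCZ` gate on a triple of qubits. -/
def tripleGate {n : ℕ} (e : {e // e ∈ edges (Fin n) 3}) : Gate (Fin n) :=
  Gate.cZ e.1 (le_of_le_of_eq (by norm_num) (Finset.mem_powersetCard.1 e.2).2.symm)
    (Finset.mem_powersetCard.1 e.2).2.le

/-- A Hadamard gate on every qubit, followed by a `CCZ` gate on every triple of qubits. -/
noncomputable def gammaCircuit (n : ℕ) : List (Gate (Fin n)) :=
  (Finset.univ : Finset (Fin n)).toList.map Gate.hadamard ++
    (edges (Fin n) 3).attach.toList.map tripleGate

theorem output_gammaCircuit (n : ℕ) : output (gammaCircuit n) = gammaKet n := by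
  ext s
  have h : output (gammaCircuit n) = applyGates ((edges (Fin n) 3).attach.toList.map tripleGate)
      (applyGates ((Finset.univ : Finset (Fin n)).toList.map Gate.hadamard) (zeroKet (Fin n))) := by
    simp only [output, gammaCircuit, List.foldl_append, applyGates]
  rw [h, applyGates_cZ (E := (edges (Fin n) 3).attach.toList.map Subtype.val)
    (by simp [tripleGate, Gate.toOp, Function.comp_def]), applyGates_hadamard (Finset.nodup_toList _)]
  simp only [Finset.mem_toList, Finset.mem_univ, not_true_eq_false, false_imp_iff, implies_true,
    if_true, Finset.length_toList, gammaKet, hypergraphKet, Finset.card_univ, List.map_map]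
  congr 1
  rw [← Finset.prod_attach]
  exact Finset.prod_map_toList _ _

theorem length_gammaCircuit (n : ℕ) : (gammaCircuit n).length = n + n.choose 3 := by
  rw [gammaCircuit, List.length_append, List.length_map, List.length_map, Finset.length_toList,
    Finset.length_toList, Finset.card_attach, edges, Finset.card_powersetCard, Finset.card_univ,
    Fintype.card_fin]

theorem length_gammaCircuit_le (n : ℕ) : (gammaCircuit n).length ≤ 2 * n ^ 3 := by
  rw [length_gammaCircuit]
  have h1 := Nat.choose_le_pow n 3
  have h2 := Nat.le_self_pow (three_ne_zero) n
  omega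

theorem efficientlyPreparable_gamma : EfficientlyPreparable gammaKet :=
  ⟨2 * Polynomial.X ^ 3, fun n => ⟨gammaCircuit n, output_gammaCircuit n, by
    simpa using length_gammaCircuit_le n⟩⟩

theorem isBigO_length_gammaCircuit :
    (fun n => ((gammaCircuit n).length : ℝ)) =O[atTop] (fun n : ℕ => (n : ℝ) ^ 3) := by
  refine Asymptotics.IsBigO.of_bound 2 (Eventually.of_forall fun n => ?_)
  rw [Real.norm_of_nonneg (by positivity), Real.norm_of_nonneg (by positivity)]
  exact_mod_cast length_gammaCircuit_le n

end MagicThreshold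

theorem mainTheorem3 :
    -- existence of such families
    (∃ ψ : (n : ℕ) → Ket (Fin n),
      EfficientlyPreparable ψ ∧
      VanishingLocalMagic (fun n => proj (ψ n)) ∧
      ∀ ε : ℝ, 0 ≤ ε → NonvanishingMagicThreshold ε (fun n => proj (ψ n))) ∧
    -- the example: gate complexity
    (∃ C : (n : ℕ) → List (Gate (Fin n)),
      (∀ n, output (C n) = gammaKet n) ∧
      (fun n => ((C n).length : ℝ)) =O[atTop] (fun n : ℕ => (n : ℝ) ^ 3)) ∧
    -- the marginals on `K` qubits tend, uniformly over the choice of the qubits, to a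
    -- stabilizer state
    (∀ (ι : Type) [Fintype ι] [DecidableEq ι], fourMixture ι ∈ STAB ι) ∧
    (∀ K : ℕ, ∀ δ : ℝ, 0 < δ → ∀ᶠ n in atTop, ∀ J : Finset (Fin n), J.card = K →
      ∀ a b, ‖reduced J (proj (gammaKet n)) a b - fourMixture J a b‖ < δ) ∧
    -- vanishing local magic and a non-vanishing magic threshold
    VanishingLocalMagic (fun n => proj (gammaKet n)) ∧
    (∀ ε : ℝ, 0 ≤ ε → NonvanishingMagicThreshold ε (fun n => proj (gammaKet n))) ∧
    (∀ ε : ℝ, 0 ≤ ε → ∀ᶠ n in atTop,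
      0.39 ≤ magicThreshold ε (proj (gammaKet n)) ∧
      magicThreshold ε (proj (gammaKet n)) ≤ 0.78) :=
  ⟨⟨gammaKet, efficientlyPreparable_gamma, vanishingLocalMagic_gamma,
      nonvanishingMagicThreshold_gamma⟩,
    ⟨gammaCircuit, output_gammaCircuit, isBigO_length_gammaCircuit⟩,
    fun _ _ _ => fourMixture_mem_STAB, tendsto_reduced_gamma, vanishingLocalMagic_gamma,
    nonvanishingMagicThreshold_gamma, magicThreshold_gamma⟩
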